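/- \textbf{Setting.} Let $1\le d\le 10$, $\Omega=(0,2\pi)^d$, $\phi_k(x)=(2\pi)^{-d/2}e^{ik\cdot x}$ ($k\in\mathbb Z^d$), $c_k=\sqrt{1+|k|^2}$ with $|\cdot|$ the Euclidean norm, and let $\omega_d$ be the volume of the Euclidean unit ball of $\mathbb R^d$. Let $V=H^1_p(\Omega)$ be the space of complex-valued $2\pi$-periodic $H^1$ functions with norm $\|v\|^2=\|v\|_{L^2}^2+\|\nabla v\|_{L^2}^2$, and let $V'=H^{-1}_p(\Omega)$ be the space of continuous antilinear forms on $V$ with the dual norm. Let $\nu,\sigma$ be real measurable functions on $\Omega$, bounded and bounded below by positive constants, let $$a(u,v)=\int_\Omega \nu\,\nabla u\cdot\overline{\nabla v}+\int_\Omega\sigma\,u\,\overline v ,$$ and let $L:V\to V'$ be given by $\langle Lu,v\rangle=a(u,v)$. The stiffness matrix $\mathbf A=(a_{\ell,k})_{\ell,k\in\mathbb Z^d}$ has entries $a_{\ell,k}=\frac{1}{c_\ell c_k}a(\phi_k,\phi_\ell)$, and $\mathbf A^{-1}$ denotes its inverse on $\ell^2(\mathbb Z^d)$. A matrix $\mathbf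 M=(m_{\ell,k})$ belongs to $\mathcal D_e(\eta)$ if there is $c>0$ with $|m_{\ell,k}|\le c\,e^{-\eta|\ell-k|}$ for all $\ell,k$. For a finite set $\Lambda\subset\mathbb Z^d$ let $V_\Lambda=\mathrm{span}\{\phi_k:k\in\Lambda\}$ and, for $f\in V'$, let $u_\Lambda\in V_\Lambda$ be the Galerkin solution, $a(u_\Lambda,v)=\langle f,v\rangle$ for all $v\in V_\Lambda$; its residual is $r(u_\Lambda)=f-Lu_\Lambda\in V'$. For $v\in V$ let $P_\Lambda v=\sum_{k\in\Lambda}\hat v_k\phi_k$ with $\hat v_k=(v,\phi_k)_{L^2}$, and for $f\in V'$ let $P_\Lambda f=\sum_{k\in\Lambda}\langle f,\phi_k\rangle\phi_k$, where $\phi_k$ is identified with the form $v\mapsto(\phi_k,v)_{L^2}$. For $w$ in $V$ or in $V'$ put $E_N(w)=\inf_{|\Lambda|=N}\|w-P_\Lambda w\|$, the norm being that of $V$, respectively $V'$, and, for $\eta>0$ and $0<t\le d$, $$\|w\|_{\mathcal A^{\eta,t}_G}=\sup_{N\ge0}E_N(w)\exp\big(\eta\,\omega_d^{-t/d}N^{t/d}\big),\qquad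 w\in\mathcal A^{\eta,t}_G\iff\|w\|_{\mathcal A^{\eta,t}_G}<\infty .$$ \textbf{Proposition (sparsity class of the residual, exponential case).} Let $\eta>0$ and $0<t\le d$. There are $\bar\eta\in(0,\eta]$, depending only on $d,\eta,t$, and $\bar t=\frac{t}{1+3t}\in(0,t]$ such that the following holds. Let $\mathbf A\in\mathcal D_e(\eta_L)$ and $\mathbf A^{-1}\in\mathcal D_e(\bar\eta_L)$ with $0<\bar\eta_L\le\eta_L$, and let $$\eta<\omega_d^{\,t/(d(1+2t))}\,\bar\eta_L .$$ Then there is a constant $C$ (which may depend on $d,\eta,t,\nu,\sigma,\eta_L,\bar\eta_L$) such that for all $f\in V'$ whose solution $u\in V$ of $Lu=f$ lies in $\mathcal A^{\eta,t}_G$ and for every finite $\Lambda\subset\mathbb Z^d$, the Galerkin residual satisfies $$r(u_\Lambda)\in\mathcal A^{\bar\eta,\bar t}_G\qquad\text{and}\qquad\|r(u_\Lambda)\|_{\mathcal A^{\bar\eta,\bar t}_G}\le C\,\|u\|_{\mathcal A^{\eta,t}_G}.$$ -/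

import Mathlib

open MeasureTheory
open scoped NNReal ENNReal ContDiff ComplexConjugate

namespace FourierGalerkin

/-! ### Periodic functions on the cube, the trigonometric basis -/

/-- The cube `Ω = (0, 2π)^d`. -/
def cube (d : ℕ) : Set (Fin d → ℝ) := Set.univ.pi fun _ => Set.Ioo 0 (2 * Real.pi)

/-- Lebesgue measure on `Ω`. -/
noncomputable abbrev cubeMeasure (d : ℕ) : Measure (Fin d → ℝ) := volume.restrict (cube d)

/-- `L²(Ω)`, complex valued. -/
noncomputable abbrev L2 (d : ℕ) := Lp ℂ 2 (cubeMeasure d)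

/-- Smooth functions on `ℝ^d` that are `2π`-periodic in each variable. -/
def IsSmoothPeriodic (d : ℕ) (ψ : (Fin d → ℝ) → ℂ) : Prop :=
  ContDiff ℝ ∞ ψ ∧ ∀ (j : Fin d) (x : Fin d → ℝ), ψ (x + Pi.single j (2 * Real.pi)) = ψ x

/-- The partial derivative `∂_j ψ`. -/
noncomputable def partialDeriv {d : ℕ} (j : Fin d) (ψ : (Fin d → ℝ) → ℂ) (x : Fin d → ℝ) : ℂ :=
  fderiv ℝ ψ x (Pi.single j 1)

/-- `g` is the weak partial derivative `∂_j v` of the periodic function `v`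
(test functions are the smooth periodic functions, so that the periodic boundary conditions
are part of the notion). -/
def IsWeakDeriv {d : ℕ} (j : Fin d) (v g : L2 d) : Prop :=
  ∀ ψ : (Fin d → ℝ) → ℂ, IsSmoothPeriodic d ψ →
    ∫ x in cube d, v x * partialDeriv j ψ x = -∫ x in cube d, g x * ψ x

/-- `φ_k(x) = (2π)^{-d/2} exp(i k·x)`. -/
noncomputable def phiFun {d : ℕ} (k : Fin d → ℤ) (x : Fin d → ℝ) : ℂ :=
  (((2 * Real.pi) ^ (-(d : ℝ) / 2) : ℝ) : ℂ) *
    Complex.exp (Complex.I * ((∑ j, (k j : ℝ) * x j : ℝ) : ℂ))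

/-- The Euclidean norm `|k|` of a multi-index. -/
noncomputable def freqNorm {d : ℕ} (k : Fin d → ℤ) : ℝ := Real.sqrt (∑ j, (k j : ℝ) ^ 2)

/-- `c_k = √(1 + |k|²)`. -/
noncomputable def cWeight {d : ℕ} (k : Fin d → ℤ) : ℝ := Real.sqrt (1 + freqNorm k ^ 2)

/-- `ω_d`, the Lebesgue measure of the Euclidean unit ball of `ℝ^d`. -/
noncomputable def omega (d : ℕ) : ℝ :=
  (volume (Metric.ball (0 : EuclideanSpace ℝ (Fin d)) 1)).toReal

/-! Helper facts: integrability on the cube and integration by parts. -/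

instance isFiniteMeasure_cubeMeasure (d : ℕ) : IsFiniteMeasure (cubeMeasure d) := by
  refine ⟨?_⟩
  rw [Measure.restrict_apply_univ]
  have h : cube d ⊆ Set.Icc (fun _ => 0) (fun _ => 2 * Real.pi) := by
    intro x hx
    exact ⟨fun j => (hx j (Set.mem_univ _)).1.le, fun j => (hx j (Set.mem_univ _)).2.le⟩
  exact lt_of_le_of_lt (measure_mono h) isCompact_Icc.measure_lt_top

theorem measurableSet_cube (d : ℕ) : MeasurableSet (cube d) :=
  MeasurableSet.univ_pi fun _ => measurableSet_Ioo

theorem memLp_of_continuous {d : ℕ} {ψ : (Fin d → ℝ) → ℂ} (hψ : Continuous ψ) :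
    MemLp ψ 2 (cubeMeasure d) := by
  obtain ⟨C, hC⟩ := (isCompact_Icc (a := fun _ : Fin d => (0 : ℝ))
    (b := fun _ => 2 * Real.pi)).exists_bound_of_continuousOn hψ.continuousOn
  refine MemLp.of_bound hψ.aestronglyMeasurable C ?_
  refine (ae_restrict_iff' (measurableSet_cube d)).2 (Filter.Eventually.of_forall fun x hx => ?_)
  exact hC x ⟨fun j => (hx j (Set.mem_univ _)).1.le, fun j => (hx j (Set.mem_univ _)).2.le⟩

theorem integrable_L2_mul {d : ℕ} (v : L2 d) {ψ : (Fin d → ℝ) → ℂ} (hψ : Continuous ψ) :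
    Integrable (fun x => v x * ψ x) (cubeMeasure d) :=
  (Lp.memLp v).integrable_mul (memLp_of_continuous hψ)

theorem continuous_partialDeriv {d : ℕ} (j : Fin d) {ψ : (Fin d → ℝ) → ℂ}
    (hψ : ContDiff ℝ ∞ ψ) : Continuous (partialDeriv j ψ) :=
  (hψ.continuous_fderiv (by simp)).clm_apply continuous_const

theorem isWeakDeriv_zero {d : ℕ} (j : Fin d) : IsWeakDeriv j (0 : L2 d) 0 := by
  intro ψ _
  have h0 := Lp.coeFn_zero ℂ 2 (cubeMeasure d)
  have h1 : ∀ b : (Fin d → ℝ) → ℂ, ∫ x in cube d, (0 : L2 d) x * b x = 0 := fun b =>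
    integral_eq_zero_of_ae (h0.mono fun x hx => by
      change (0 : L2 d) x * b x = 0
      rw [hx]
      simp)
  rw [h1, h1, neg_zero]

theorem IsWeakDeriv.add {d : ℕ} {j : Fin d} {v v' g g' : L2 d} (h : IsWeakDeriv j v g)
    (h' : IsWeakDeriv j v' g') : IsWeakDeriv j (v + v') (g + g') := by
  intro ψ hψ
  have hc := hψ.1.continuous
  have hd := continuous_partialDeriv j hψ.1
  have key : ∀ (p q : L2 d) (b : (Fin d → ℝ) → ℂ), Continuous b →
      ∫ x in cube d, (p + q : L2 d) x * b x
        = (∫ x in cube d, p x * b x) + ∫ x in cube d, q x * b x := by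
    intro p q b hb
    rw [← integral_add (integrable_L2_mul p hb) (integrable_L2_mul q hb)]
    refine integral_congr_ae ((Lp.coeFn_add p q).mono fun x hx => ?_)
    change (p + q : L2 d) x * b x = p x * b x + q x * b x
    rw [hx, Pi.add_apply, add_mul]
  rw [key v v' _ hd, key g g' _ hc, h ψ hψ, h' ψ hψ, neg_add]

theorem IsWeakDeriv.smul {d : ℕ} {j : Fin d} {v g : L2 d} (c : ℂ) (h : IsWeakDeriv j v g) :
    IsWeakDeriv j (c • v) (c • g) := by
  intro ψ hψ
  have key : ∀ (p : L2 d) (b : (Fin d → ℝ) → ℂ),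
      ∫ x in cube d, (c • p : L2 d) x * b x = c * ∫ x in cube d, p x * b x := by
    intro p b
    rw [← integral_const_mul]
    refine integral_congr_ae ((Lp.coeFn_smul c p).mono fun x hx => ?_)
    change (c • p : L2 d) x * b x = c * (p x * b x)
    rw [hx, Pi.smul_apply, smul_eq_mul, mul_assoc]
  rw [key, key, h ψ hψ, mul_neg]

/-- The integral over the cube of a partial derivative of a periodic function vanishes. -/
theorem integral_partialDeriv {d : ℕ} (j : Fin d) {F : (Fin d → ℝ) → ℂ}
    (hF : IsSmoothPeriodic d F) : ∫ x in cube d, partialDeriv j F x = 0 := by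
  obtain _ | n := d
  · exact j.elim0
  have hcube : cube (n + 1) =ᵐ[volume] Set.Icc (fun _ => (0 : ℝ)) (fun _ => 2 * Real.pi) :=
    Measure.univ_pi_Ioo_ae_eq_Icc
  rw [setIntegral_congr_set hcube]
  have hdiff : Differentiable ℝ F := hF.1.differentiable (by simp)
  have hle : (fun _ => (0 : ℝ) : Fin (n + 1) → ℝ) ≤ fun _ => 2 * Real.pi := fun _ =>
    Real.two_pi_pos.le
  have key := integral_divergence_of_hasFDerivAt_off_countable' (E := ℂ)
    (fun _ => (0 : ℝ)) (fun _ => 2 * Real.pi) hle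
    (fun i => if i = j then F else 0) (fun i x => if i = j then fderiv ℝ F x else 0) ∅
    Set.countable_empty
    (fun i => by
      by_cases hi : i = j
      · simpa [hi] using hF.1.continuous.continuousOn
      · simp only [hi, if_false]
        exact continuousOn_const)
    (fun x _ i => by
      by_cases hi : i = j
      · simpa [hi] using (hdiff x).hasFDerivAt
      · simp only [hi, if_false]
        exact hasFDerivAt_const (0 : ℂ) x)
    (by
      have : Continuous (partialDeriv j F) := continuous_partialDeriv j hF.1
      refine (ContinuousOn.integrableOn_compact isCompact_Icc ?_)
      refine this.continuousOn.congr fun x _ => ?_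
      rw [Finset.sum_eq_single j]
      · simp [partialDeriv]
      · intro i _ hi
        simp [hi]
      · simp)
  have hl : ∀ x : Fin (n + 1) → ℝ,
      ∑ i, (if i = j then fderiv ℝ F x else 0) (Pi.single i 1) = partialDeriv j F x := by
    intro x
    rw [Finset.sum_eq_single j]
    · simp [partialDeriv]
    · intro i _ hi
      simp [hi]
    · simp
  simp only [hl] at key
  rw [key]
  refine Finset.sum_eq_zero fun i _ => ?_
  by_cases hi : i = j
  · subst hi
    simp only [if_true]
    rw [sub_eq_zero]
    refine integral_congr_ae (Filter.Eventually.of_forall fun x => ?_)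
    have : i.insertNth (2 * Real.pi) x
        = (i.insertNth 0 x : Fin (n + 1) → ℝ) + Pi.single i (2 * Real.pi) := by
      funext m
      refine Fin.succAboveCases i ?_ (fun m => ?_) m
      · simp
      · simp
    change F _ = F _
    rw [this, hF.2]
  · simp [hi]

theorem contDiff_phiFun {d : ℕ} (k : Fin d → ℤ) : ContDiff ℝ ∞ (phiFun k) := by
  have h' : ContDiff ℝ ∞ fun x : Fin d → ℝ => ∑ j, (k j : ℝ) * x j :=
    ContDiff.sum fun j _ => contDiff_const.mul (contDiff_apply ℝ ℝ j)
  have h : ContDiff ℝ ∞ fun x : Fin d → ℝ => ((∑ j, (k j : ℝ) * x j : ℝ) : ℂ) :=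
    Complex.ofRealCLM.contDiff.comp h'
  exact contDiff_const.mul (contDiff_const.mul h).cexp

theorem isSmoothPeriodic_phiFun {d : ℕ} (k : Fin d → ℤ) : IsSmoothPeriodic d (phiFun k) := by
  refine ⟨contDiff_phiFun k, fun j x => ?_⟩
  have h : ∑ m, (k m : ℝ) * (x + Pi.single j (2 * Real.pi) : Fin d → ℝ) m
      = (∑ m, (k m : ℝ) * x m) + (k j : ℝ) * (2 * Real.pi) := by
    simp only [Pi.add_apply, mul_add, Finset.sum_add_distrib]
    congr 1
    rw [Finset.sum_eq_single j]
    · simp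
    · intro m _ hm
      simp [Pi.single_eq_of_ne hm]
    · simp
  unfold phiFun
  rw [h]
  congr 1
  rw [Complex.exp_eq_exp_iff_exists_int]
  refine ⟨k j, ?_⟩
  push_cast
  ring

theorem partialDeriv_phiFun {d : ℕ} (j : Fin d) (k : Fin d → ℤ) (x : Fin d → ℝ) :
    partialDeriv j (phiFun k) x = Complex.I * (k j : ℂ) * phiFun k x := by
  have h1 : HasFDerivAt (fun x : Fin d → ℝ => ∑ m, (k m : ℝ) * x m)
      (∑ m, (k m : ℝ) • ContinuousLinearMap.proj (R := ℝ) (φ := fun _ : Fin d => ℝ) m) x :=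
    HasFDerivAt.fun_sum fun m _ => (hasFDerivAt_apply m x).const_mul _
  have h2 := (Complex.ofRealCLM.hasFDerivAt.comp x h1)
  have h3 := ((h2.const_mul Complex.I).cexp).const_mul
    (((2 * Real.pi) ^ (-(d : ℝ) / 2) : ℝ) : ℂ)
  have h4 : HasFDerivAt (phiFun k) _ x := h3
  unfold partialDeriv
  rw [h4.fderiv]
  have h5 : ∑ m, (k m : ℝ) * (Pi.single j (1 : ℝ) : Fin d → ℝ) m = k j := by
    rw [Finset.sum_eq_single j]
    · simp
    · intro m _ hm
      simp [Pi.single_eq_of_ne hm]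
    · simp
  simp only [_root_.smul_apply, ContinuousLinearMap.comp_apply,
    _root_.sum_apply, ContinuousLinearMap.proj_apply, smul_eq_mul, h5, phiFun,
    Complex.ofRealCLM_apply, Function.comp]
  push_cast
  ring

/-- `φ_k` as an element of `L²(Ω)`. -/
noncomputable def phiL2 {d : ℕ} (k : Fin d → ℤ) : L2 d :=
  (memLp_of_continuous (contDiff_phiFun k).continuous).toLp (phiFun k)

theorem isWeakDeriv_phiL2 {d : ℕ} (j : Fin d) (k : Fin d → ℤ) :
    IsWeakDeriv j (phiL2 k) ((Complex.I * (k j : ℂ)) • phiL2 k) := by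
  intro ψ hψ
  have hφ := isSmoothPeriodic_phiFun k
  have hae : (phiL2 k : (Fin d → ℝ) → ℂ) =ᵐ[cubeMeasure d] phiFun k := MemLp.coeFn_toLp _
  have hprod : IsSmoothPeriodic d fun x => phiFun k x * ψ x :=
    ⟨hφ.1.mul hψ.1, fun i x => by
      change phiFun k _ * ψ _ = phiFun k x * ψ x
      rw [hφ.2 i x, hψ.2 i x]⟩
  have h0 := integral_partialDeriv j hprod
  have hpt : ∀ x, partialDeriv j (fun x => phiFun k x * ψ x) x
      = phiFun k x * partialDeriv j ψ x + (Complex.I * (k j : ℂ) * phiFun k x) * ψ x := by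
    intro x
    rw [← partialDeriv_phiFun]
    unfold partialDeriv
    rw [fderiv_fun_mul (hφ.1.differentiable (by simp) x) (hψ.1.differentiable (by simp) x)]
    simp only [_root_.add_apply, _root_.smul_apply, smul_eq_mul]
    ring
  have hi : ∀ {a b : (Fin d → ℝ) → ℂ}, Continuous a → Continuous b →
      Integrable (fun x => a x * b x) (cubeMeasure d) := fun ha hb =>
    (memLp_of_continuous ha).integrable_mul (memLp_of_continuous hb)
  simp only [hpt] at h0
  have hi1 := hi hφ.1.continuous (continuous_partialDeriv j hψ.1)
  have hi2 : Integrable (fun x => (Complex.I * (k j : ℂ) * phiFun k x) * ψ x) (cubeMeasure d) :=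
    hi (a := fun x => Complex.I * (k j : ℂ) * phiFun k x)
      (continuous_const.mul hφ.1.continuous) hψ.1.continuous
  rw [integral_add hi1 hi2] at h0
  have e1 : ∫ x in cube d, phiL2 k x * partialDeriv j ψ x
      = ∫ x in cube d, phiFun k x * partialDeriv j ψ x :=
    integral_congr_ae (hae.mono fun x hx => by
      change phiL2 k x * _ = phiFun k x * _
      rw [hx])
  have e2 : ∫ x in cube d, ((Complex.I * (k j : ℂ)) • phiL2 k : L2 d) x * ψ x
      = ∫ x in cube d, (Complex.I * (k j : ℂ) * phiFun k x) * ψ x :=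
    integral_congr_ae (((Lp.coeFn_smul (Complex.I * (k j : ℂ)) (phiL2 k)).and hae).mono
      fun x hx => by
        change ((Complex.I * (k j : ℂ)) • phiL2 k : L2 d) x * ψ x = _
        rw [hx.1, Pi.smul_apply, smul_eq_mul, hx.2])
  rw [e1, e2]
  exact eq_neg_of_add_eq_zero_left h0

/-! ### The space `V = H¹_p(Ω)` and its dual -/

/-- `V = H¹_p(Ω)`: the periodic functions `v ∈ L²(Ω)` with weak gradient in `L²(Ω)^d`, realized as
the pairs `(v, ∇v)`. The inherited norm is the `H¹` norm, `‖v‖² = ‖v‖²_{L²} + ∑_j ‖∂_j v‖²_{L²}`. -/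
noncomputable def V (d : ℕ) :
    Submodule ℂ (WithLp 2 (L2 d × PiLp 2 (fun _ : Fin d => L2 d))) where
  carrier := {p | ∀ j, IsWeakDeriv j p.fst (p.snd j)}
  zero_mem' := fun j => isWeakDeriv_zero j
  add_mem' := fun hp hq j => (hp j).add (hq j)
  smul_mem' := fun c _ hp j => (hp j).smul c

/-- The function `v ∈ L²(Ω)` underlying an element of `V`. -/
noncomputable def toL2 (d : ℕ) : V d →L[ℂ] L2 d :=
  (WithLp.fstL 2 ℂ (L2 d) (PiLp 2 (fun _ : Fin d => L2 d))).comp (V d).subtypeL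

/-- The weak partial derivative `∂_j v ∈ L²(Ω)` of an element of `V`. -/
noncomputable def grad {d : ℕ} (j : Fin d) : V d →L[ℂ] L2 d :=
  (PiLp.proj 2 (𝕜 := ℂ) (fun _ : Fin d => L2 d) j).comp
    ((WithLp.sndL 2 ℂ (L2 d) (PiLp 2 (fun _ : Fin d => L2 d))).comp (V d).subtypeL)

/-- `φ_k` as an element of `V`. -/
noncomputable def phi {d : ℕ} (k : Fin d → ℤ) : V d :=
  ⟨WithLp.toLp 2 (phiL2 k, WithLp.toLp 2 fun j => (Complex.I * (k j : ℂ)) • phiL2 k),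
    fun j => isWeakDeriv_phiL2 j k⟩

/-- `H^{-1}_p(Ω)`: the continuous antilinear forms on `V`, with the dual norm.
(Antilinear because the forms are paired with `a(u, v)`, which is antilinear in `v`.) -/
abbrev Vdual (d : ℕ) := V d →L⋆[ℂ] ℂ

/-- The Fourier coefficient `v̂_k = (v, φ_k) = ∫ v conj φ_k`. -/
noncomputable def coeff {d : ℕ} (v : V d) (k : Fin d → ℤ) : ℂ := inner ℂ (phiL2 k) (toL2 d v)

/-- The projection `P_Λ v = ∑_{k ∈ Λ} v̂_k φ_k`. -/
noncomputable def proj {d : ℕ} (Λ : Finset (Fin d → ℤ)) (v : V d) : V d :=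
  ∑ k ∈ Λ, coeff v k • phi k

/-- `φ_k` as an element of the dual space, `⟨φ_k, v⟩ = (φ_k, v) = ∫ φ_k conj v`. -/
noncomputable def phiDual {d : ℕ} (k : Fin d → ℤ) : Vdual d :=
  (innerSLFlip ℂ (phiL2 k)).comp (toL2 d)

/-- The projection `P_Λ f = ∑_{k ∈ Λ} f̂_k φ_k` of a form `f`, with `f̂_k = ⟨f, φ_k⟩`. -/
noncomputable def projDual {d : ℕ} (Λ : Finset (Fin d → ℤ)) (f : Vdual d) : Vdual d :=
  ∑ k ∈ Λ, f (phi k) • phiDual k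

/-! ### The elliptic operator, its stiffness matrix and Galerkin approximation -/

/-- Real measurable coefficients `ν, σ` on `Ω`, both bounded, and bounded away from zero. -/
structure Coefficients (d : ℕ) where
  ν : (Fin d → ℝ) → ℝ
  σ : (Fin d → ℝ) → ℝ
  ν_meas : AEStronglyMeasurable ν (cubeMeasure d)
  σ_meas : AEStronglyMeasurable σ (cubeMeasure d)
  ν_bounds : ∃ a b : ℝ, 0 < a ∧ ∀ x ∈ cube d, a ≤ ν x ∧ ν x ≤ b
  σ_bounds : ∃ a b : ℝ, 0 < a ∧ ∀ x ∈ cube d, a ≤ σ x ∧ σ x ≤ b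

/-- `a(u, v) = ∫ ν ∇u · conj ∇v + ∫ σ u conj v`. -/
noncomputable def energyForm {d : ℕ} (K : Coefficients d) (u v : V d) : ℂ :=
  (∫ x in cube d, (K.ν x : ℂ) * ∑ j, grad j u x * conj (grad j v x)) +
    ∫ x in cube d, (K.σ x : ℂ) * (toL2 d u x * conj (toL2 d v x))

theorem memLp_mul_of_bounds {d : ℕ} {m : (Fin d → ℝ) → ℝ}
    (hm : AEStronglyMeasurable m (cubeMeasure d))
    (hb : ∃ a b : ℝ, 0 < a ∧ ∀ x ∈ cube d, a ≤ m x ∧ m x ≤ b) (p : L2 d) :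
    MemLp (fun x => (m x : ℂ) * p x) 2 (cubeMeasure d) := by
  obtain ⟨a, b, ha, hab⟩ := hb
  refine MemLp.of_le_mul (c := b) (Lp.memLp p)
    ((Complex.continuous_ofReal.comp_aestronglyMeasurable hm).mul
      (Lp.aestronglyMeasurable p)) ?_
  refine (ae_restrict_iff' (measurableSet_cube d)).2 (Filter.Eventually.of_forall fun x hx => ?_)
  have h := hab x hx
  rw [norm_mul, Complex.norm_real, Real.norm_of_nonneg (ha.le.trans h.1)]
  exact mul_le_mul_of_nonneg_right h.2 (norm_nonneg _)

theorem inner_eq_integral {d : ℕ} {m : (Fin d → ℝ) → ℝ} (p q : L2 d)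
    (h : MemLp (fun x => (m x : ℂ) * p x) 2 (cubeMeasure d)) :
    inner ℂ q (h.toLp _) = ∫ x in cube d, (m x : ℂ) * (p x * conj (q x)) := by
  rw [L2.inner_def]
  refine integral_congr_ae (h.coeFn_toLp.mono fun x hx => ?_)
  simp only [hx, RCLike.inner_apply]
  ring

theorem integrable_mul_conj {d : ℕ} {m : (Fin d → ℝ) → ℝ} (p q : L2 d)
    (h : MemLp (fun x => (m x : ℂ) * p x) 2 (cubeMeasure d)) :
    Integrable (fun x => (m x : ℂ) * (p x * conj (q x))) (cubeMeasure d) := by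
  have hq : MemLp (fun x => conj (q x)) 2 (cubeMeasure d) := (Lp.memLp q).star
  refine (h.integrable_mul hq).congr (Filter.Eventually.of_forall fun x => ?_)
  simp [mul_assoc]

theorem energyForm_eq {d : ℕ} (K : Coefficients d) (u v : V d) :
    energyForm K u v =
      (∑ j, inner ℂ (grad j v)
        ((memLp_mul_of_bounds K.ν_meas K.ν_bounds (grad j u)).toLp _)) +
      inner ℂ (toL2 d v) ((memLp_mul_of_bounds K.σ_meas K.σ_bounds (toL2 d u)).toLp _) := by
  unfold energyForm
  simp only [inner_eq_integral]
  congr 1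
  rw [← integral_finsetSum _ fun j _ => integrable_mul_conj _ _
    (memLp_mul_of_bounds K.ν_meas K.ν_bounds (grad j u))]
  simp only [Finset.mul_sum]

/-- The operator `L : V → V'`, `⟨L u, v⟩ = a(u, v)`. -/
noncomputable def opL {d : ℕ} (K : Coefficients d) (u : V d) : Vdual d where
  toFun v := energyForm K u v
  map_add' v w := by
    simp only [energyForm_eq, map_add, inner_add_left, Finset.sum_add_distrib]
    ring
  map_smul' c v := by
    simp only [energyForm_eq, map_smul, inner_smul_left, smul_eq_mul, mul_add, Finset.mul_sum]
  cont := by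
    simp only [energyForm_eq]
    fun_prop

/-- `V_Λ = span {φ_k : k ∈ Λ}`. -/
noncomputable def VΛ {d : ℕ} (Λ : Finset (Fin d → ℤ)) : Submodule ℂ (V d) :=
  Submodule.span ℂ (phi '' (Λ : Set (Fin d → ℤ)))

/-- `w` is the Galerkin approximation `u_Λ` for the right-hand side `f`. -/
def IsGalerkin {d : ℕ} (K : Coefficients d) (f : Vdual d) (Λ : Finset (Fin d → ℤ))
    (w : V d) : Prop :=
  w ∈ VΛ Λ ∧ ∀ v ∈ VΛ Λ, energyForm K w v = f v

/-- The residual `r(w) = f - L w`. -/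
noncomputable def galerkinResidual {d : ℕ} (K : Coefficients d) (f : Vdual d) (w : V d) : Vdual d :=
  f - opL K w

/-- The stiffness matrix `A`, with entries `a(φ_k, φ_ℓ) / (c_ℓ c_k)`. -/
noncomputable def stiffness {d : ℕ} (K : Coefficients d) (l k : Fin d → ℤ) : ℂ :=
  energyForm K (phi k) (phi l) / ((cWeight l : ℂ) * (cWeight k : ℂ))

/-- The exponential class `𝒟_e(η)`: `|m_{ℓ,k}| ≤ c e^{-η |ℓ - k|}` for a constant `c > 0`. -/
def ExpDecay {d : ℕ} (M : (Fin d → ℤ) → (Fin d → ℤ) → ℂ) (η : ℝ) : Prop :=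
  ∃ c : ℝ, 0 < c ∧ ∀ l k, ‖M l k‖ ≤ c * Real.exp (-η * freqNorm (l - k))

/-- `ℓ²(ℤ^d)`. -/
noncomputable abbrev ell2 (d : ℕ) := lp (fun _ : Fin d → ℤ => ℂ) 2

/-- `M` is the bi-infinite matrix of the bounded operator `T` on `ℓ²(ℤ^d)`. -/
def IsMatrixOf {d : ℕ} (M : (Fin d → ℤ) → (Fin d → ℤ) → ℂ) (T : ell2 d →L[ℂ] ell2 d) : Prop :=
  ∀ l k, M l k = T (lp.single 2 k (1 : ℂ)) l

/-- `B = A^{-1}` as operators on `ℓ²(ℤ^d)`. -/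
def IsInverseMatrix {d : ℕ} (A B : (Fin d → ℤ) → (Fin d → ℤ) → ℂ) : Prop :=
  ∃ S T : ell2 d →L[ℂ] ell2 d, IsMatrixOf A S ∧ IsMatrixOf B T ∧
    S.comp T = ContinuousLinearMap.id ℂ (ell2 d) ∧ T.comp S = ContinuousLinearMap.id ℂ (ell2 d)

/-! ### Best `N`-term approximation and exponential sparsity classes -/

/-- The best `N`-term approximation error of `v ∈ V`. -/
noncomputable def bestError {d : ℕ} (N : ℕ) (v : V d) : ℝ :=
  ⨅ Λ : {Λ : Finset (Fin d → ℤ) // Λ.card = N}, ‖v - proj Λ.1 v‖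

/-- The best `N`-term approximation error of `f ∈ V'`. -/
noncomputable def bestErrorDual {d : ℕ} (N : ℕ) (f : Vdual d) : ℝ :=
  ⨅ Λ : {Λ : Finset (Fin d → ℤ) // Λ.card = N}, ‖f - projDual Λ.1 f‖

/-- The weight `exp(η ω_d^{-t/d} N^{t/d})`. -/
noncomputable def gevreyWeight (d : ℕ) (η t : ℝ) (N : ℕ) : ℝ :=
  Real.exp (η * omega d ^ (-(t / d)) * (N : ℝ) ^ (t / d))

/-- `‖v‖_{𝒜_G^{η,t}} = sup_{N ≥ 0} E_N(v) exp(η ω_d^{-t/d} N^{t/d}) ∈ [0, ∞]`, for `v ∈ V`. -/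
noncomputable def sparsityNorm {d : ℕ} (η t : ℝ) (v : V d) : ℝ≥0∞ :=
  ⨆ N : ℕ, ENNReal.ofReal (bestError N v * gevreyWeight d η t N)

/-- `‖f‖_{𝒜_G^{η,t}} = sup_{N ≥ 0} E_N(f) exp(η ω_d^{-t/d} N^{t/d}) ∈ [0, ∞]`, for `f ∈ V'`. -/
noncomputable def sparsityNormDual {d : ℕ} (η t : ℝ) (f : Vdual d) : ℝ≥0∞ :=
  ⨆ N : ℕ, ENNReal.ofReal (bestErrorDual N f * gevreyWeight d η t N)

/-- The sparsity class `𝒜_G^{η,t}` of functions in `V`. -/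
def SparsityClass (d : ℕ) (η t : ℝ) : Set (V d) := {v | sparsityNorm η t v < ⊤}

/-- The sparsity class `𝒜_G^{η,t}` of forms in `V'`. -/
def SparsityClassDual (d : ℕ) (η t : ℝ) : Set (Vdual d) := {f | sparsityNormDual η t f < ⊤}

end FourierGalerkin

open FourierGalerkin

/-! In the orthonormal basis `φ_k / c_k` of `V` the stiffness matrix is the matrix of a bounded
coercive operator `T`, and the residual is the form `v ↦ ⟪v, T (u - u_Λ)⟫`. The estimate is a
Combes–Thomas argument, uniform in the Galerkin set `Λ`.

Let `Λ₀` be an `N`-term set for `u`, and let `W` be the diagonal operator with weights `exp (θ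
ρ(k))`, where `ρ` is the distance to `Λ₀` truncated at `J`. Exponential decay of the stiffness
matrix and the Schur test `norm_le_tsum_of_matrix_le` show that, for `θ` small, `W T W⁻¹` differs
from `T` by at most half the coercivity constant, so it is still coercive. A diagonal `W` leaves
`V_Λ` invariant, so Galerkin orthogonality survives the conjugation and `‖W u_Λ‖` is controlled by
`‖W u‖`, which is at most `‖u‖ + exp (θ J) ‖u - P_{Λ₀} u‖`. Tested on functions with no modes in the
`J`-neighbourhood of `Λ₀`, where `W = exp (θ J)`, the residual is therefore at most a constant times
`exp (-θ J) ‖u‖ + ‖u - P_{Λ₀} u‖` (`norm_residual_le`, `exists_residual_bound`).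

The neighbourhood has at most `N (2J+1)^d` elements. Splitting a budget `N'` as `N ≈ N'^(1/(1+2t))`
and `(2J+1)^d ≈ N'^(2t/(1+2t))` makes both terms decay like `exp (-c N'^(s/d))` with `s ≥ t/(1+2t) >
t/(1+3t)`. The strict gap absorbs all rates, so `η̄ = η` is possible (`exists_balanced_parameters`).
-/

namespace FourierGalerkin

/-! ### Matrices, diagonal weights and Galerkin residuals in an abstract Hilbert space. -/

section Hilbert

variable {ι H : Type*} [NormedAddCommGroup H] [InnerProductSpace ℂ H]

/-- Finite Schur test for a matrix dominated by a summable Toeplitz kernel. -/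
theorem sum_kernel_le [AddCommGroup ι] {κ : ι → ℝ} (hκ0 : ∀ m, 0 ≤ κ m) (hκ : Summable κ)
    (s : Finset ι) (x y : ι → ℝ) :
    ∑ p ∈ s ×ˢ s, κ (p.1 - p.2) * (y p.1 * x p.2) ≤
      (∑' m, κ m) * (√(∑ l ∈ s, y l ^ 2) * √(∑ k ∈ s, x k ^ 2)) := by
  have hs0 : 0 ≤ ∑' m, κ m := tsum_nonneg hκ0
  have hrow : ∀ l, ∑ k ∈ s, κ (l - k) ≤ ∑' m, κ m := fun l => by
    have hi : Function.Injective fun k : ι => l - k := sub_right_injective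
    calc ∑ k ∈ s, κ (l - k) = ∑ m ∈ s.map ⟨_, hi⟩, κ m := by simp
      _ ≤ _ := hκ.sum_le_tsum _ fun _ _ => hκ0 _
  have hcol : ∀ k, ∑ l ∈ s, κ (l - k) ≤ ∑' m, κ m := fun k => by
    have hi : Function.Injective fun l : ι => l - k := sub_left_injective
    calc ∑ l ∈ s, κ (l - k) = ∑ m ∈ s.map ⟨_, hi⟩, κ m := by simp
      _ ≤ _ := hκ.sum_le_tsum _ fun _ _ => hκ0 _
  -- Cauchy–Schwarz is applied with `κ = √κ · √κ`, one root going with each vector; row and column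
  -- sums of a Toeplitz kernel are both at most `∑' m, κ m`.
  have h1 : ∑ p ∈ s ×ˢ s, (√(κ (p.1 - p.2)) * y p.1) ^ 2 ≤ (∑' m, κ m) * ∑ l ∈ s, y l ^ 2 := by
    rw [Finset.sum_product, Finset.mul_sum]
    refine Finset.sum_le_sum fun l _ => ?_
    simp only [mul_pow, Real.sq_sqrt (hκ0 _)]
    rw [← Finset.sum_mul]
    exact mul_le_mul_of_nonneg_right (hrow l) (sq_nonneg _)
  have h2 : ∑ p ∈ s ×ˢ s, (√(κ (p.1 - p.2)) * x p.2) ^ 2 ≤ (∑' m, κ m) * ∑ k ∈ s, x k ^ 2 := by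
    rw [Finset.sum_product_right, Finset.mul_sum]
    refine Finset.sum_le_sum fun l _ => ?_
    simp only [mul_pow, Real.sq_sqrt (hκ0 _)]
    rw [← Finset.sum_mul]
    exact mul_le_mul_of_nonneg_right (hcol l) (sq_nonneg _)
  calc ∑ p ∈ s ×ˢ s, κ (p.1 - p.2) * (y p.1 * x p.2)
      = ∑ p ∈ s ×ˢ s, (√(κ (p.1 - p.2)) * y p.1) * (√(κ (p.1 - p.2)) * x p.2) := by
        refine Finset.sum_congr rfl fun p _ => ?_
        nth_rewrite 1 [← Real.mul_self_sqrt (hκ0 (p.1 - p.2))]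
        ring
    _ ≤ _ := Real.sum_mul_le_sqrt_mul_sqrt _ _ _
    _ ≤ √((∑' m, κ m) * ∑ l ∈ s, y l ^ 2) * √((∑' m, κ m) * ∑ k ∈ s, x k ^ 2) := by gcongr
    _ = _ := by
        rw [Real.sqrt_mul hs0, Real.sqrt_mul hs0, mul_mul_mul_comm, Real.mul_self_sqrt hs0]

/-- Schur test: an operator whose matrix is dominated by a summable Toeplitz kernel. -/
theorem norm_le_tsum_of_matrix_le [AddCommGroup ι] (b : HilbertBasis ι ℂ H) (T : H →L[ℂ] H)
    {κ : ι → ℝ} (hκ : Summable κ) (hT : ∀ l k, ‖inner ℂ (b l) (T (b k))‖ ≤ κ (l - k)) :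
    ‖T‖ ≤ ∑' m, κ m := by
  have hκ0 : ∀ m, 0 ≤ κ m := fun m => by simpa using (norm_nonneg _).trans (hT m 0)
  have hs0 : 0 ≤ ∑' m, κ m := tsum_nonneg hκ0
  have key : ∀ x y : H, ‖inner ℂ y (T x)‖ ≤ (∑' m, κ m) * (‖y‖ * ‖x‖) := by
    intro x y
    have hx := b.hasSum_repr x
    have hy := b.hasSum_repr y
    have hlim : Filter.Tendsto (fun s : Finset ι =>
        ‖inner ℂ (∑ l ∈ s, b.repr y l • b l) (T (∑ k ∈ s, b.repr x k • b k))‖) Filter.atTop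
        (nhds ‖inner ℂ y (T x)‖) :=
      (Filter.Tendsto.inner hy ((T.continuous.tendsto _).comp hx)).norm
    have hlim2 : Filter.Tendsto (fun s : Finset ι =>
        (∑' m, κ m) * (‖∑ l ∈ s, b.repr y l • b l‖ * ‖∑ k ∈ s, b.repr x k • b k‖)) Filter.atTop
        (nhds ((∑' m, κ m) * (‖y‖ * ‖x‖))) :=
      (Filter.Tendsto.mul (Filter.Tendsto.norm hy) (Filter.Tendsto.norm hx)).const_mul _
    refine le_of_tendsto_of_tendsto' hlim hlim2 fun s => ?_
    have hn : ∀ z : H, ‖∑ l ∈ s, b.repr z l • b l‖ = √(∑ l ∈ s, ‖b.repr z l‖ ^ 2) := by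
      intro z
      rw [@norm_eq_sqrt_re_inner ℂ, b.orthonormal.inner_sum]
      congr 1
      simp only [map_sum]
      refine Finset.sum_congr rfl fun l _ => ?_
      rw [← Complex.normSq_eq_conj_mul_self, Complex.normSq_eq_norm_sq]
      exact Complex.ofReal_re _
    rw [hn, hn]
    refine le_trans ?_ (sum_kernel_le hκ0 hκ s (fun k => ‖b.repr x k‖) fun l => ‖b.repr y l‖)
    simp only [map_sum, map_smul, sum_inner, inner_sum, inner_smul_left, inner_smul_right,
      Finset.mul_sum]
    rw [Finset.sum_product_right]
    refine (norm_sum_le _ _).trans (Finset.sum_le_sum fun k _ => (norm_sum_le _ _).trans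
      (Finset.sum_le_sum fun l _ => ?_))
    rw [norm_mul, norm_mul, RCLike.norm_conj]
    have := mul_le_mul_of_nonneg_left (hT l k)
      (mul_nonneg (norm_nonneg (b.repr y l)) (norm_nonneg (b.repr x k)))
    calc _ = ‖b.repr y l‖ * ‖b.repr x k‖ * ‖inner ℂ (b l) (T (b k))‖ := by ring
      _ ≤ _ := this.trans_eq (by ring)
  refine T.opNorm_le_bound hs0 fun x => ?_
  have h := key x (T x)
  rw [inner_self_eq_norm_sq_to_K, norm_pow, RCLike.norm_ofReal, abs_norm] at h
  rcases (norm_nonneg (T x)).eq_or_lt with h0 | h0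
  · rw [← h0]; positivity
  · refine le_of_mul_le_mul_left ?_ h0
    linarith

/-- The diagonal operator with finitely many entries different from `c`. -/
theorem exists_diagonal (b : HilbertBasis ι ℂ H) (S : Finset ι) (w : ι → ℝ) (c : ℝ)
    (hw : ∀ k ∉ S, w k = c) :
    ∃ W : H →L[ℂ] H, ∀ l x, inner ℂ (b l) (W x) = w l * inner ℂ (b l) x := by
  classical
  -- Constant weights outside `S` make the operator a multiple of the identity plus a finite-rank
  -- correction, so boundedness is automatic.
  refine ⟨(c : ℂ) • ContinuousLinearMap.id ℂ H + ∑ k ∈ S,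
    ((w k - c : ℝ) : ℂ) • (innerSL ℂ (b k)).smulRight (b k), fun l x => ?_⟩
  have ho : ∀ k, inner ℂ (b l) (b k) = if l = k then (1 : ℂ) else 0 :=
    orthonormal_iff_ite.1 b.orthonormal l
  simp only [_root_.add_apply, _root_.smul_apply, _root_.sum_apply, inner_add_right, inner_sum,
    inner_smul_right, ContinuousLinearMap.smulRight_apply, ho, innerSL_apply_apply,
    ContinuousLinearMap.id_apply]
  by_cases hl : l ∈ S
  · simp [hl]
    ring
  · simp [hl, hw l hl]

variable {b : HilbertBasis ι ℂ H}

theorem ext_inner_basis (b : HilbertBasis ι ℂ H) {x y : H}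
    (h : ∀ l, inner ℂ (b l) x = inner ℂ (b l) y) : x = y :=
  b.repr.injective (lp.ext (funext fun l => by simpa [b.repr_apply_apply] using h l))

theorem diagonal_inner_comm {W : H →L[ℂ] H} {w : ι → ℝ}
    (hW : ∀ l x, inner ℂ (b l) (W x) = w l * inner ℂ (b l) x) (x y : H) :
    inner ℂ (W x) y = inner ℂ x (W y) := by
  rw [← b.tsum_inner_mul_inner, ← b.tsum_inner_mul_inner]
  refine tsum_congr fun l => ?_
  rw [hW, ← inner_conj_symm (W x), hW, map_mul, Complex.conj_ofReal, inner_conj_symm]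
  ring

theorem diagonal_norm_le {W : H →L[ℂ] H} {w : ι → ℝ} {c : ℝ}
    (hW : ∀ l x, inner ℂ (b l) (W x) = w l * inner ℂ (b l) x) (hc : ∀ l, |w l| ≤ c) (hc0 : 0 ≤ c)
    (x : H) : ‖W x‖ ≤ c * ‖x‖ := by
  have hs : ∀ z : H, HasSum (fun l => ‖inner ℂ (b l) z‖ ^ 2) (‖z‖ ^ 2) := fun z => by
    have h := (Complex.hasSum_re (b.hasSum_inner_mul_inner z z))
    rw [inner_self_eq_norm_sq_to_K] at h
    convert! h using 1
    · funext l
      rw [← inner_conj_symm, Complex.mul_conj, Complex.ofReal_re, RCLike.norm_conj,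
        Complex.normSq_eq_norm_sq]
    · norm_cast
  have h := hasSum_le (fun l => ?_) (hs (W x)) ((hs x).mul_left (c ^ 2))
  · rw [← mul_pow] at h
    exact le_of_sq_le_sq h (by positivity)
  · rw [hW, norm_mul, mul_pow, Complex.norm_real, Real.norm_eq_abs]
    gcongr
    exact hc l

theorem diagonal_basis {W : H →L[ℂ] H} {w : ι → ℝ}
    (hW : ∀ l x, inner ℂ (b l) (W x) = w l * inner ℂ (b l) x) (k : ι) :
    W (b k) = (w k : ℂ) • b k := by
  classical
  refine ext_inner_basis b fun l => ?_
  rw [hW, inner_smul_right]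
  have := orthonormal_iff_ite.1 b.orthonormal l k
  rw [this]
  split_ifs with h <;> simp [h]

/-- Weighted (Combes–Thomas type) decay estimate for the residual of a Galerkin approximation:
the weight `w` is `1` on `Λ₀` and maximal, equal to `c`, outside `S`. -/
theorem norm_residual_le {T : H →L[ℂ] H} {α : ℝ} (hα : 0 < α)
    (hT : ∀ x, α * ‖x‖ ^ 2 ≤ (inner ℂ x (T x)).re)
    [AddCommGroup ι] {w : ι → ℝ} {c : ℝ} {S Λ₀ Λ : Finset ι}
    (hw1 : ∀ k, 1 ≤ w k) (hwc : ∀ k, w k ≤ c) (hwS : ∀ k ∉ S, w k = c) (hwΛ : ∀ k ∈ Λ₀, w k = 1)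
    {κ : ι → ℝ} (hκ : Summable κ) (hκα : ∑' m, κ m ≤ α / 2)
    (hTκ : ∀ l k, |w l / w k - 1| * ‖inner ℂ (b l) (T (b k))‖ ≤ κ (l - k))
    {u z : H} (hz : z ∈ Submodule.span ℂ (b '' (Λ : Set ι)))
    (hg : ∀ v ∈ Submodule.span ℂ (b '' (Λ : Set ι)), inner ℂ v (T (u - z)) = 0)
    {v : H} (hv : ∀ k ∈ S, inner ℂ (b k) v = 0) :
    ‖inner ℂ v (T (u - z))‖ ≤ (‖T‖ + α / 2) * (1 + 2 * (‖T‖ + α / 2) / α) *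
      (c⁻¹ * ‖u‖ + ‖u - ∑ k ∈ Λ₀, inner ℂ (b k) u • b k‖) * ‖v‖ := by
  classical
  have hc1 : 1 ≤ c := (hw1 0).trans (hwc 0)
  have hc0 : 0 < c := one_pos.trans_le hc1
  have hw0 : ∀ k, 0 < w k := fun k => one_pos.trans_le (hw1 k)
  obtain ⟨W, hW⟩ := exists_diagonal b S w c hwS
  obtain ⟨W', hW'⟩ := exists_diagonal b S (fun k => (w k)⁻¹) c⁻¹ fun k hk => by rw [hwS k hk]
  have hWW' : ∀ x, W' (W x) = x := fun x => ext_inner_basis b fun l => by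
    rw [hW', hW, ← mul_assoc, ← Complex.ofReal_mul, inv_mul_cancel₀ (hw0 l).ne']
    simp
  set R : H →L[ℂ] H := W ∘L T ∘L W' with hR
  have hRW : ∀ x y, inner ℂ y (R (W x)) = inner ℂ (W y) (T x) := fun x y => by
    simp only [hR, ContinuousLinearMap.comp_apply, hWW']
    rw [diagonal_inner_comm hW]
  -- The entries of `W T W⁻¹ - T` are `(w l / w k - 1) T_{lk}`, which is what `hTκ` bounds.
  have hRT : ‖R - T‖ ≤ α / 2 := by
    refine (norm_le_tsum_of_matrix_le b _ hκ fun l k => ?_).trans hκα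
    refine le_trans (le_of_eq ?_) (hTκ l k)
    have h1 : inner ℂ (b l) (R (b k)) = ((w l / w k : ℝ) : ℂ) * inner ℂ (b l) (T (b k)) := by
      simp only [hR, ContinuousLinearMap.comp_apply, hW, diagonal_basis hW' k, map_smul,
        inner_smul_right]
      push_cast
      ring
    rw [_root_.sub_apply, inner_sub_right, h1, ← sub_one_mul, norm_mul]
    congr 1
    rw [← Real.norm_eq_abs, ← Complex.norm_real]
    push_cast
    rfl
  set M := ‖T‖ + α / 2 with hM
  have hM0 : 0 ≤ M := by positivity
  have hRM : ‖R‖ ≤ M := by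
    calc ‖R‖ = ‖T + (R - T)‖ := by rw [add_sub_cancel]
      _ ≤ _ := (norm_add_le _ _).trans (by rw [hM]; gcongr)
  have hRi : ∀ p q : H, ‖inner ℂ p (R q)‖ ≤ M * (‖p‖ * ‖q‖) := fun p q =>
    (norm_inner_le_norm _ _).trans (by
      calc ‖p‖ * ‖R q‖ ≤ ‖p‖ * (M * ‖q‖) := by gcongr; exact R.le_of_opNorm_le hRM q
        _ = _ := by ring)
  have hRco : ∀ x, α / 2 * ‖x‖ ^ 2 ≤ (inner ℂ x (R x)).re := fun x => by
    have h1 : inner ℂ x (R x) = inner ℂ x (T x) + inner ℂ x ((R - T) x) := by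
      rw [← inner_add_right]
      simp
    have h2 : ‖inner ℂ x ((R - T) x)‖ ≤ α / 2 * ‖x‖ ^ 2 :=
      (norm_inner_le_norm _ _).trans (by
        calc ‖x‖ * ‖(R - T) x‖ ≤ ‖x‖ * (α / 2 * ‖x‖) := by
              gcongr; exact (R - T).le_of_opNorm_le hRT x
          _ = _ := by ring)
    have h3 := (abs_le.1 ((Complex.abs_re_le_norm _).trans h2)).1
    rw [h1, Complex.add_re]
    linarith [hT x]
  have hWΛ : ∀ y ∈ Submodule.span ℂ (b '' (Λ : Set ι)),
      W y ∈ Submodule.span ℂ (b '' (Λ : Set ι)) := fun y hy => by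
    induction hy using Submodule.span_induction with
    | mem y hy =>
      obtain ⟨k, hk, rfl⟩ := hy
      rw [diagonal_basis hW]
      exact Submodule.smul_mem _ _ (Submodule.subset_span ⟨k, hk, rfl⟩)
    | zero => simp
    | add y y' _ _ h h' => rw [map_add]; exact add_mem h h'
    | smul a y _ h => rw [map_smul]; exact Submodule.smul_mem _ _ h
  have hzW := hWΛ z hz
  -- `W` is self-adjoint and preserves the span, so this is Galerkin orthogonality of `u - z`
  -- against the test vector `W (W z)`.
  have horth : inner ℂ (W z) (R (W u - W z)) = 0 := by
    rw [← map_sub, hRW]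
    exact hg _ (hWΛ _ hzW)
  -- Céa-type stability for the conjugated problem, whose coercivity constant is `α / 2`.
  have hzn : ‖W z‖ ≤ 2 * M / α * ‖W u‖ := by
    have h1 : α / 2 * ‖W z‖ ^ 2 ≤ M * (‖W z‖ * ‖W u‖) := by
      refine (hRco (W z)).trans ?_
      have : inner ℂ (W z) (R (W z)) = inner ℂ (W z) (R (W u)) := by
        rw [map_sub, inner_sub_right, sub_eq_zero] at horth
        exact horth.symm
      rw [this]
      exact (Complex.re_le_norm _).trans (hRi _ _)
    rcases (norm_nonneg (W z)).eq_or_lt with h0 | h0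
    · rw [← h0]; positivity
    · have h2 : α / 2 * ‖W z‖ ≤ M * ‖W u‖ := by
        refine le_of_mul_le_mul_left ?_ h0
        linarith
      rw [div_mul_eq_mul_div, le_div_iff₀ hα]
      linarith
  set P := ∑ k ∈ Λ₀, inner ℂ (b k) u • b k with hP
  have hWP : W P = P := by
    simp only [hP, map_sum, map_smul, diagonal_basis hW]
    refine Finset.sum_congr rfl fun k hk => by rw [hwΛ k hk]; simp
  have hPn : ‖P‖ ≤ ‖u‖ := by
    have h1 : inner ℂ P (u - P) = 0 := by
      rw [inner_sub_right, sub_eq_zero, hP, b.orthonormal.inner_sum]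
      simp only [sum_inner, inner_smul_left]
    have h2 := norm_add_sq_eq_norm_sq_add_norm_sq_of_inner_eq_zero P (u - P) h1
    rw [add_sub_cancel] at h2
    nlinarith [norm_nonneg P, norm_nonneg u, mul_self_nonneg ‖u - P‖]
  -- `W` is the identity on the `Λ₀`-part and costs at most a factor `c` on the remainder.
  have hun : ‖W u‖ ≤ ‖u‖ + c * ‖u - P‖ := by
    calc ‖W u‖ = ‖P + W (u - P)‖ := by rw [map_sub, hWP, add_sub_cancel]
      _ ≤ ‖P‖ + ‖W (u - P)‖ := norm_add_le _ _
      _ ≤ _ := add_le_add hPn (diagonal_norm_le hW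
          (fun l => by rw [abs_of_pos (hw0 l)]; exact hwc l) hc0.le _)
  have hWv : W v = (c : ℂ) • v := ext_inner_basis b fun l => by
    rw [hW, inner_smul_right]
    by_cases hl : l ∈ S
    · rw [hv l hl, mul_zero, mul_zero]
    · rw [hwS l hl]
  -- The gain: moving `W` onto `v`, where it equals `c`, puts the factor `c` on the left.
  have hmain : c * ‖inner ℂ v (T (u - z))‖ ≤ M * (‖v‖ * ‖W u - W z‖) := by
    have : inner ℂ v (R (W u - W z)) = c * inner ℂ v (T (u - z)) := by
      rw [← map_sub, hRW, hWv, inner_smul_left, Complex.conj_ofReal]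
    have h := hRi v (W u - W z)
    rwa [this, norm_mul, Complex.norm_real, Real.norm_of_nonneg hc0.le] at h
  have hsub : ‖W u - W z‖ ≤ (1 + 2 * M / α) * (‖u‖ + c * ‖u - P‖) := by
    calc ‖W u - W z‖ ≤ ‖W u‖ + ‖W z‖ := norm_sub_le _ _
      _ ≤ ‖W u‖ + 2 * M / α * ‖W u‖ := by gcongr
      _ = (1 + 2 * M / α) * ‖W u‖ := by ring
      _ ≤ _ := by gcongr
  have hfin : c * ‖inner ℂ v (T (u - z))‖ ≤
      M * (‖v‖ * ((1 + 2 * M / α) * (‖u‖ + c * ‖u - P‖))) := hmain.trans (by gcongr)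
  refine le_of_mul_le_mul_left (hfin.trans_eq ?_) hc0
  field_simp

theorem inner_basis_sub_sum (b : HilbertBasis ι ℂ H) {Λ : Finset ι} {k : ι} (hk : k ∈ Λ) (v : H) :
    inner ℂ (b k) (v - ∑ k ∈ Λ, inner ℂ (b k) v • b k) = 0 := by
  classical
  rw [inner_sub_right, inner_sum]
  simp [inner_smul_right, orthonormal_iff_ite.1 b.orthonormal, hk]

theorem norm_sub_sum_le (b : HilbertBasis ι ℂ H) (Λ : Finset ι) (v : H) :
    ‖v - ∑ k ∈ Λ, inner ℂ (b k) v • b k‖ ≤ ‖v‖ := by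
  set P := ∑ k ∈ Λ, inner ℂ (b k) v • b k with hP
  have h1 : inner ℂ P (v - P) = 0 := by
    nth_rewrite 1 [hP]
    simp only [sum_inner, inner_smul_left]
    exact Finset.sum_eq_zero fun k hk => by rw [inner_basis_sub_sum b hk, mul_zero]
  have h2 := norm_add_sq_eq_norm_sq_add_norm_sq_of_inner_eq_zero _ _ h1
  rw [add_sub_cancel] at h2
  nlinarith [norm_nonneg v, norm_nonneg (v - P), mul_self_nonneg ‖P‖]

/-- The operator representing a bounded Hermitian form. -/
theorem exists_operator_of_form [CompleteSpace H] {a : H → H → ℂ}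
    (hadd : ∀ u v w, a u (v + w) = a u v + a u w)
    (hsmul : ∀ (c : ℂ) u v, a u (c • v) = conj c * a u v)
    (hconj : ∀ u v, conj (a u v) = a v u) {M : ℝ} (hM : ∀ u v, ‖a u v‖ ≤ M * ‖u‖ * ‖v‖) :
    ∃ T : H →L[ℂ] H, ∀ u v, inner ℂ v (T u) = a u v := by
  -- The arguments are swapped because the representation theorem wants conjugate-linearity in the
  -- first slot, whereas `a` is conjugate-linear in the second.
  let B : H →ₗ⋆[ℂ] H →ₗ[ℂ] ℂ := LinearMap.mk₂'ₛₗ (starRingEnd ℂ) (RingHom.id ℂ)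
    (fun u v => a v u)
    (fun u v w => hadd _ _ _)
    (fun c u v => hsmul _ _ _)
    (fun u v w => by rw [← hconj, hadd, map_add, hconj, hconj])
    (fun c u v => by
      rw [← hconj, hsmul, map_mul, hconj, Complex.conj_conj]
      rfl)
  let B' : H →L⋆[ℂ] H →L[ℂ] ℂ := B.mkContinuous₂ M fun u v => (hM v u).trans_eq (by ring)
  refine ⟨InnerProductSpace.continuousLinearMapOfBilin B', fun u v => ?_⟩
  rw [← inner_conj_symm, InnerProductSpace.continuousLinearMapOfBilin_apply]
  exact hconj v u

end Hilbert

/-! ### Orthonormality and completeness of the trigonometric system on the cube, transferred from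
the unit torus. -/

section Torus

/-- Haar measure, as in the construction of `UnitAddTorus.mFourierBasis`. -/
noncomputable local instance : MeasureSpace UnitAddCircle := ⟨AddCircle.haarAddCircle⟩

local instance : Measure.IsAddHaarMeasure (volume : Measure UnitAddCircle) :=
  inferInstanceAs (Measure.IsAddHaarMeasure AddCircle.haarAddCircle)

local instance : IsProbabilityMeasure (volume : Measure UnitAddCircle) :=
  inferInstanceAs (IsProbabilityMeasure AddCircle.haarAddCircle)

/-- The representative in `(0, 2π]^d` of a point of the torus. -/
noncomputable def torusLift (d : ℕ) (y : UnitAddTorus (Fin d)) : Fin d → ℝ :=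
  (2 * Real.pi) • (UnitAddTorus.measurableEquivPiIoc (fun _ => 0) y).1

/-- The torus carries a probability measure, hence the factor `(2π)^{-d}`. The half-open cube hit by
the lift and the open cube differ by a null set. -/
theorem measurePreserving_torusLift (d : ℕ) :
    MeasurePreserving (torusLift d) volume
      (ENNReal.ofReal |((2 * Real.pi) ^ d)⁻¹| • cubeMeasure d) := by
  have h1 := UnitAddTorus.measurePreserving_equivPiIoc (d := Fin d) (fun _ => 0)
  have hm : MeasurableSet {x : Fin d → ℝ | ∀ i, x i ∈ Set.Ioc (0 : ℝ) (0 + 1)} :=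
    MeasurableSet.univ_pi' fun _ => measurableSet_Ioc
  have h2 := measurePreserving_subtype_coe (μa := (volume : Measure (Fin d → ℝ))) hm
  have h3 : MeasurePreserving (fun x : Fin d → ℝ => (2 * Real.pi) • x)
      (volume.restrict {x : Fin d → ℝ | ∀ i, x i ∈ Set.Ioc (0 : ℝ) (0 + 1)})
      (ENNReal.ofReal |((2 * Real.pi) ^ d)⁻¹| • cubeMeasure d) := by
    refine ⟨measurable_const_smul _, ?_⟩
    have hae : cube d =ᵐ[volume] Set.univ.pi fun _ => Set.Ioc (0 : ℝ) (2 * Real.pi) :=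
      Measure.univ_pi_Ioo_ae_eq_Icc.trans Measure.univ_pi_Ioc_ae_eq_Icc.symm
    have hpre : {x : Fin d → ℝ | ∀ i, x i ∈ Set.Ioc (0 : ℝ) (0 + 1)} =
        (fun x : Fin d → ℝ => (2 * Real.pi) • x) ⁻¹'
          Set.univ.pi fun _ => Set.Ioc (0 : ℝ) (2 * Real.pi) := by
      ext x
      simp only [Set.mem_ofPred_eq, Set.mem_preimage, Set.mem_pi, Set.mem_univ, true_imp_iff,
        Pi.smul_apply, smul_eq_mul, Set.mem_Ioc, zero_add]
      refine forall_congr' fun i => ?_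
      rw [mul_pos_iff_of_pos_left Real.two_pi_pos, mul_le_iff_le_one_right Real.two_pi_pos]
    rw [hpre, ← Measure.restrict_map (measurable_const_smul _)
      (MeasurableSet.univ_pi fun _ => measurableSet_Ioc),
      Measure.map_addHaar_smul _ Real.two_pi_pos.ne', Measure.restrict_smul,
      ← Measure.restrict_congr_set hae]
    simp
  exact (h3.comp h2).comp h1

theorem phiFun_torusLift {d : ℕ} (k : Fin d → ℤ) (y : UnitAddTorus (Fin d)) :
    phiFun k (torusLift d y) =
      (((2 * Real.pi) ^ (-(d : ℝ) / 2) : ℝ) : ℂ) * UnitAddTorus.mFourier k y := by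
  unfold phiFun
  congr 1
  have h : ∀ i, fourier (k i) (y i) =
      Complex.exp (Complex.I * ((k i : ℝ) * torusLift d y i : ℝ)) := fun i => by
    have : y i = (((AddCircle.equivIoc 1 0 (y i)).1 : ℝ) : UnitAddCircle) :=
      ((AddCircle.equivIoc 1 0).symm_apply_apply (y i)).symm
    rw [this, fourier_coe_apply]
    congr 1
    simp only [torusLift, UnitAddTorus.coe_measurableEquivPiIoc_apply, Pi.smul_apply, smul_eq_mul]
    push_cast
    ring
  simp only [UnitAddTorus.mFourier, ContinuousMap.coe_mk, h, ← Complex.exp_sum]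
  push_cast
  rw [Finset.mul_sum]

theorem coeFn_phiL2 {d : ℕ} (k : Fin d → ℤ) : phiL2 k =ᵐ[cubeMeasure d] phiFun k :=
  MemLp.coeFn_toLp _

theorem inner_phiL2 {d : ℕ} (k : Fin d → ℤ) (f : L2 d) :
    inner ℂ (phiL2 k) f = ∫ x in cube d, f x * conj (phiFun k x) := by
  rw [L2.inner_def]
  refine integral_congr_ae ((coeFn_phiL2 k).mono fun x hx => ?_)
  simp only [hx, RCLike.inner_apply]

theorem integral_torusLift {d : ℕ} {g : (Fin d → ℝ) → ℂ}
    (hg : AEStronglyMeasurable g (cubeMeasure d)) :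
    ∫ y, g (torusLift d y) = (((2 * Real.pi) ^ d)⁻¹ : ℝ) * ∫ x in cube d, g x := by
  have hp := measurePreserving_torusLift d
  rw [← integral_map hp.measurable.aemeasurable, hp.map_eq, integral_smul_measure]
  · rw [abs_of_nonneg (by positivity), ENNReal.toReal_ofReal (by positivity), Complex.real_smul]
  · rw [hp.map_eq]
    exact hg.smul_measure _

theorem orthonormal_phiL2 (d : ℕ) : Orthonormal ℂ (phiL2 (d := d)) := by
  rw [orthonormal_iff_ite]
  intro k l
  have hc : Continuous fun x : Fin d → ℝ => phiFun l x * conj (phiFun k x) :=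
    (contDiff_phiFun l).continuous.mul
      (Complex.continuous_conj.comp (contDiff_phiFun k).continuous)
  have h0 := orthonormal_iff_ite.1 (UnitAddTorus.orthonormal_mFourier (d := Fin d)) k l
  rw [ContinuousMap.inner_toLp] at h0
  have h1 : inner ℂ (phiL2 k) (phiL2 l) = ∫ x in cube d, phiFun l x * conj (phiFun k x) := by
    rw [inner_phiL2]
    exact integral_congr_ae ((coeFn_phiL2 l).mono fun x hx => by
      change phiL2 l x * _ = _
      rw [hx])
  have h2 := integral_torusLift hc.aestronglyMeasurable
  have h3 : ∀ y, phiFun l (torusLift d y) * conj (phiFun k (torusLift d y)) =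
      (((2 * Real.pi) ^ d)⁻¹ : ℝ) *
        (UnitAddTorus.mFourier l y * conj (UnitAddTorus.mFourier k y)) := fun y => by
    rw [phiFun_torusLift, phiFun_torusLift, map_mul, Complex.conj_ofReal, mul_mul_mul_comm,
      ← Complex.ofReal_mul, ← Real.rpow_add Real.two_pi_pos, neg_div, ← neg_add, add_halves,
      Real.rpow_neg Real.two_pi_pos.le, Real.rpow_natCast]
  simp only [h3] at h2
  rw [integral_const_mul] at h2
  have h4 := mul_left_cancel₀ (by
    rw [Complex.ofReal_ne_zero]
    exact (inv_pos.2 (pow_pos Real.two_pi_pos d)).ne') h2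
  rw [h1, ← h4]
  exact h0

/-- The pullback of `f` to the torus has vanishing Fourier coefficients, so it is zero by
completeness there; the pushforward measure has the same null sets as `cubeMeasure d`. -/
theorem eq_zero_of_inner_phiL2 {d : ℕ} {f : L2 d} (hf : ∀ k, inner ℂ (phiL2 k) f = 0) :
    f = 0 := by
  have hp := measurePreserving_torusLift d
  have hc0 : ENNReal.ofReal |((2 * Real.pi) ^ d)⁻¹| ≠ 0 := by
    rw [Ne, ENNReal.ofReal_eq_zero, not_le, abs_pos]
    exact (inv_pos.2 (pow_pos Real.two_pi_pos d)).ne'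
  have hmem : MemLp (f ∘ torusLift d) 2 volume :=
    MemLp.comp_measurePreserving ((Lp.memLp f).smul_measure ENNReal.ofReal_ne_top) hp
  have hF : hmem.toLp _ = 0 := by
    refine ext_inner_basis UnitAddTorus.mFourierBasis fun k => ?_
    rw [inner_zero_right, ← HilbertBasis.repr_apply_apply, UnitAddTorus.mFourierBasis_repr,
      UnitAddTorus.mFourierCoeff]
    have h1 := integral_torusLift (d := d) (g := fun x => f x * conj (phiFun k x))
      ((Lp.aestronglyMeasurable f).mul
        (Complex.continuous_conj.comp (contDiff_phiFun k).continuous).aestronglyMeasurable)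
    rw [← inner_phiL2, hf k, mul_zero] at h1
    simp only [phiFun_torusLift, map_mul, Complex.conj_ofReal, mul_left_comm _ (Complex.ofReal _)]
      at h1
    rw [integral_const_mul, mul_eq_zero, Complex.ofReal_eq_zero,
      or_iff_right (Real.rpow_pos_of_pos Real.two_pi_pos _).ne'] at h1
    rw [← h1]
    refine integral_congr_ae (hmem.coeFn_toLp.mono fun y hy => ?_)
    simp only [hy, UnitAddTorus.mFourier_neg, smul_eq_mul, Function.comp, mul_comm]
  have h0 : f ∘ torusLift d =ᵐ[volume] 0 := by
    have := hmem.coeFn_toLp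
    rw [hF] at this
    exact this.symm.trans (Lp.coeFn_zero _ _ _)
  have hmap : ∀ᵐ x ∂(Measure.map (torusLift d) volume), f x = 0 := by
    rw [ae_map_iff hp.measurable.aemeasurable]
    · exact h0
    · exact (Lp.stronglyMeasurable f).measurable (measurableSet_singleton 0)
  rw [hp.map_eq, Measure.ae_ennreal_smul_measure_iff hc0] at hmap
  exact (Lp.eq_zero_iff_ae_eq_zero).2 hmap

end Torus

/-! ### `V` as a Hilbert space with its Fourier basis. -/

variable {d : ℕ}

theorem continuous_integral_L2_mul {ψ : (Fin d → ℝ) → ℂ} (hψ : Continuous ψ) :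
    Continuous fun v : L2 d => ∫ x in cube d, v x * ψ x := by
  have hc : Continuous fun x => conj (ψ x) := Complex.continuous_conj.comp hψ
  have h : (fun v : L2 d => ∫ x in cube d, v x * ψ x) =
      fun v : L2 d => inner ℂ ((memLp_of_continuous hc).toLp) v := by
    funext v
    rw [L2.inner_def]
    refine integral_congr_ae ((memLp_of_continuous hc).coeFn_toLp.mono fun x hx => ?_)
    simp only [hx, RCLike.inner_apply, Complex.conj_conj]
  rw [h]
  fun_prop

/-- Each weak-derivative identity, for a fixed test function, is a closed condition on the pair `(v,
∇v)`. Completeness of `V` follows. -/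
theorem isClosed_V (d : ℕ) :
    IsClosed (V d : Set (WithLp 2 (L2 d × PiLp 2 (fun _ : Fin d => L2 d)))) := by
  have h : (V d : Set (WithLp 2 (L2 d × PiLp 2 (fun _ : Fin d => L2 d)))) =
      ⋂ (j : Fin d) (ψ : (Fin d → ℝ) → ℂ) (_ : IsSmoothPeriodic d ψ),
        {p | ∫ x in cube d, p.fst x * partialDeriv j ψ x =
          -∫ x in cube d, p.snd j x * ψ x} := by
    ext p
    simp only [Set.mem_iInter]
    rfl
  rw [h]
  refine isClosed_iInter fun j => isClosed_iInter fun ψ => isClosed_iInter fun hψ => ?_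
  refine isClosed_eq ?_ (Continuous.neg ?_)
  · exact (continuous_integral_L2_mul (continuous_partialDeriv j hψ.1)).comp
      (WithLp.fstL 2 ℂ (L2 d) (PiLp 2 (fun _ : Fin d => L2 d))).continuous
  · exact (continuous_integral_L2_mul hψ.1.continuous).comp
      ((PiLp.proj 2 (𝕜 := ℂ) (fun _ : Fin d => L2 d) j).comp
        (WithLp.sndL 2 ℂ (L2 d) (PiLp 2 (fun _ : Fin d => L2 d)))).continuous

instance completeSpace_V (d : ℕ) : CompleteSpace (V d) := (isClosed_V d).completeSpace_coe

noncomputable instance instInnerV (d : ℕ) : Inner ℂ (V d) := InnerProductSpace.toInner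

theorem inner_V (v w : V d) :
    inner ℂ v w = inner ℂ (toL2 d v) (toL2 d w) + ∑ j, inner ℂ (grad j v) (grad j w) := by
  rw [Submodule.coe_inner, WithLp.prod_inner_apply, PiLp.inner_apply]
  rfl

theorem norm_sq_V (v : V d) : ‖v‖ ^ 2 = ‖toL2 d v‖ ^ 2 + ∑ j, ‖grad j v‖ ^ 2 := by
  have h := congrArg Complex.re (inner_V v v)
  simp only [Complex.add_re, Complex.re_sum, inner_self_eq_norm_sq_to_K] at h
  exact_mod_cast h

theorem conj_phiFun (k : Fin d → ℤ) (x : Fin d → ℝ) : conj (phiFun k x) = phiFun (-k) x := by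
  simp only [phiFun, map_mul, Complex.conj_ofReal, ← Complex.exp_conj, Complex.conj_I]
  congr 2
  simp [Finset.sum_neg_distrib]

/-- The conjugate mode `φ_{-k}` is an admissible periodic test function, so the weak derivative acts
on coefficients as multiplication by `i k_j`. -/
theorem inner_phiL2_grad (k : Fin d → ℤ) (j : Fin d) (v : V d) :
    inner ℂ (phiL2 k) (grad j v) = Complex.I * (k j : ℂ) * coeff v k := by
  have h : IsWeakDeriv j (toL2 d v) (grad j v) := v.2 j
  have h1 := h _ (isSmoothPeriodic_phiFun (-k))
  simp only [partialDeriv_phiFun, ← conj_phiFun, mul_left_comm _ (Complex.I * _)] at h1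
  rw [integral_const_mul, ← inner_phiL2, ← inner_phiL2] at h1
  rw [coeff, ← neg_eq_iff_eq_neg.2 h1]
  simp

theorem cWeight_sq (k : Fin d → ℤ) : cWeight k ^ 2 = 1 + ∑ j, (k j : ℝ) ^ 2 := by
  have h : 0 ≤ ∑ j, (k j : ℝ) ^ 2 := Finset.sum_nonneg fun _ _ => sq_nonneg _
  rw [cWeight, freqNorm, Real.sq_sqrt h, Real.sq_sqrt (by positivity)]

theorem cWeight_pos (k : Fin d → ℤ) : 0 < cWeight k := by
  rw [cWeight]
  positivity

theorem inner_phi (k : Fin d → ℤ) (v : V d) :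
    inner ℂ (phi k) v = (cWeight k : ℂ) ^ 2 * coeff v k := by
  have hg : ∀ j, grad j (phi k) = (Complex.I * (k j : ℂ)) • phiL2 k := fun _ => rfl
  have h0 : toL2 d (phi k) = phiL2 k := rfl
  rw [inner_V, h0, ← Complex.ofReal_pow, cWeight_sq]
  simp only [hg, inner_smul_left, inner_phiL2_grad]
  push_cast
  rw [add_mul, one_mul, Finset.sum_mul, ← coeff]
  congr 1
  refine Finset.sum_congr rfl fun j _ => ?_
  simp only [map_mul, Complex.conj_I, map_intCast]
  linear_combination (-(k j : ℂ) ^ 2 * coeff v k) * Complex.I_sq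

theorem coeff_phi (k l : Fin d → ℤ) : coeff (phi l) k = if k = l then 1 else 0 :=
  orthonormal_iff_ite.1 (orthonormal_phiL2 d) k l

/-- The normalized Fourier modes `φ_k / c_k` of `V`. -/
noncomputable def modeV (k : Fin d → ℤ) : V d := ((cWeight k : ℂ)⁻¹) • phi k

theorem inner_modeV (k : Fin d → ℤ) (v : V d) :
    inner ℂ (modeV k) v = (cWeight k : ℂ) * coeff v k := by
  have h : (cWeight k : ℂ) ≠ 0 := by exact_mod_cast (cWeight_pos k).ne'
  refine (inner_smul_left (𝕜 := ℂ) (phi k) v _).trans ?_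
  rw [inner_phi, map_inv₀, Complex.conj_ofReal]
  field_simp

theorem orthonormal_modeV (d : ℕ) : Orthonormal ℂ (modeV (d := d)) := by
  rw [orthonormal_iff_ite]
  intro k l
  have h : (cWeight l : ℂ) ≠ 0 := by exact_mod_cast (cWeight_pos l).ne'
  rw [inner_modeV, modeV, coeff, map_smul, inner_smul_right, ← coeff, coeff_phi]
  split_ifs with hkl
  · rw [hkl, mul_one, mul_inv_cancel₀ h]
  · simp

theorem eq_zero_of_coeff {v : V d} (h : ∀ k, coeff v k = 0) : v = 0 := by
  have h0 : toL2 d v = 0 := eq_zero_of_inner_phiL2 h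
  have hg : ∀ j, grad j v = 0 := fun j =>
    eq_zero_of_inner_phiL2 fun k => by rw [inner_phiL2_grad, h k, mul_zero]
  have hn := norm_sq_V v
  simp only [h0, hg] at hn
  simpa using hn

/-- The Hilbert basis of `V` formed by the normalized Fourier modes. -/
noncomputable def basisV (d : ℕ) : HilbertBasis (Fin d → ℤ) ℂ (V d) :=
  HilbertBasis.mkOfOrthogonalEqBot (orthonormal_modeV d) (by
    rw [Submodule.eq_bot_iff]
    intro v hv
    refine eq_zero_of_coeff fun k => ?_
    have h := hv (modeV k) (Submodule.subset_span ⟨k, rfl⟩)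
    rw [inner_modeV, mul_eq_zero] at h
    exact h.resolve_left (by exact_mod_cast (cWeight_pos k).ne'))

theorem basisV_apply (k : Fin d → ℤ) : basisV d k = modeV k := by
  rw [basisV, HilbertBasis.coe_mkOfOrthogonalEqBot]

theorem coeff_smul_phi (v : V d) (k : Fin d → ℤ) :
    coeff v k • phi k = inner ℂ (basisV d k) v • basisV d k := by
  have h : (cWeight k : ℂ) ≠ 0 := by exact_mod_cast (cWeight_pos k).ne'
  rw [basisV_apply, inner_modeV, modeV, smul_smul, mul_right_comm, mul_inv_cancel₀ h, one_mul]

theorem proj_eq (Λ : Finset (Fin d → ℤ)) (v : V d) :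
    proj Λ v = ∑ k ∈ Λ, inner ℂ (basisV d k) v • basisV d k :=
  Finset.sum_congr rfl fun k _ => coeff_smul_phi v k

theorem VΛ_eq (Λ : Finset (Fin d → ℤ)) :
    VΛ Λ = Submodule.span ℂ (basisV d '' (Λ : Set (Fin d → ℤ))) := by
  have h : ∀ k : Fin d → ℤ, (cWeight k : ℂ) ≠ 0 := fun k => by exact_mod_cast (cWeight_pos k).ne'
  refine le_antisymm (Submodule.span_le.2 ?_) (Submodule.span_le.2 ?_)
  · rintro _ ⟨k, hk, rfl⟩
    have : phi k = (cWeight k : ℂ) • basisV d k := by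
      rw [basisV_apply, modeV, smul_smul, mul_inv_cancel₀ (h k), one_smul]
    rw [this]
    exact Submodule.smul_mem _ _ (Submodule.subset_span ⟨k, hk, rfl⟩)
  · rintro _ ⟨k, hk, rfl⟩
    rw [basisV_apply]
    exact Submodule.smul_mem _ _ (Submodule.subset_span ⟨k, hk, rfl⟩)

theorem inner_basisV_sub_proj {Λ : Finset (Fin d → ℤ)} {k : Fin d → ℤ} (hk : k ∈ Λ) (v : V d) :
    inner ℂ (basisV d k) (v - proj Λ v) = 0 := by
  rw [proj_eq]
  exact inner_basis_sub_sum (basisV d) hk v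

theorem norm_sub_proj_le (Λ : Finset (Fin d → ℤ)) (v : V d) : ‖v - proj Λ v‖ ≤ ‖v‖ := by
  rw [proj_eq]
  exact norm_sub_sum_le (basisV d) Λ v

/-- Truncating a form is the same as truncating its argument. Dual approximation errors can thus be
estimated on functions having no modes in `Λ`. -/
theorem sub_projDual_apply (Λ : Finset (Fin d → ℤ)) (f : Vdual d) (v : V d) :
    (f - projDual Λ f) v = f (v - proj Λ v) := by
  have h : ∀ k, phiDual k v = conj (coeff v k) := fun k => by
    simp [phiDual, coeff, innerSLFlip_apply_apply]
  simp only [projDual, proj, _root_.sub_apply, _root_.sum_apply, _root_.smul_apply, h, map_sub,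
    map_sum, map_smulₛₗ, smul_eq_mul, mul_comm]

/-! ### The energy form as a bounded coercive operator -/

theorem norm_toLp_mul_le {m : (Fin d → ℝ) → ℝ} {a c : ℝ} (ha : 0 < a)
    (h : ∀ x ∈ cube d, a ≤ m x ∧ m x ≤ c) (p : L2 d)
    (hm : MemLp (fun x => (m x : ℂ) * p x) 2 (cubeMeasure d)) : ‖hm.toLp‖ ≤ c * ‖p‖ := by
  refine Lp.norm_le_mul_norm_of_ae_le_mul ?_
  have hx : ∀ᵐ x ∂cubeMeasure d, x ∈ cube d := ae_restrict_mem (measurableSet_cube d)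
  filter_upwards [hm.coeFn_toLp, hx] with x h1 h2
  rw [h1, norm_mul, Complex.norm_real, Real.norm_of_nonneg (ha.le.trans (h x h2).1)]
  exact mul_le_mul_of_nonneg_right (h x h2).2 (norm_nonneg _)

theorem le_re_inner_toLp_mul {m : (Fin d → ℝ) → ℝ} {a c : ℝ}
    (h : ∀ x ∈ cube d, a ≤ m x ∧ m x ≤ c) (p : L2 d)
    (hm : MemLp (fun x => (m x : ℂ) * p x) 2 (cubeMeasure d)) :
    a * ‖p‖ ^ 2 ≤ (inner ℂ p hm.toLp).re := by
  have h0 : MemLp (fun x => (((fun _ => a : (Fin d → ℝ) → ℝ) x : ℝ) : ℂ) * p x) 2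
      (cubeMeasure d) := (Lp.memLp p).const_mul (a : ℂ)
  have e : (inner ℂ p h0.toLp).re = a * ‖p‖ ^ 2 := by
    have : h0.toLp = (a : ℂ) • p := by
      refine Lp.ext ?_
      filter_upwards [h0.coeFn_toLp, Lp.coeFn_smul (a : ℂ) p] with x h1 h2
      rw [h1, h2, Pi.smul_apply, smul_eq_mul]
    rw [this, inner_smul_right, inner_self_eq_norm_sq_to_K, Complex.re_ofReal_mul]
    norm_cast
  rw [← e, inner_eq_integral, inner_eq_integral]
  have i1 := integrable_mul_conj p p h0
  have i2 := integrable_mul_conj p p hm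
  rw [← RCLike.re_eq_complex_re, ← integral_re i1, ← integral_re i2]
  refine integral_mono_ae i1.re i2.re ?_
  have hx : ∀ᵐ x ∂cubeMeasure d, x ∈ cube d := ae_restrict_mem (measurableSet_cube d)
  filter_upwards [hx] with x hx
  simp only [Complex.mul_conj, RCLike.re_eq_complex_re, ← Complex.ofReal_mul, Complex.ofReal_re]
  exact mul_le_mul_of_nonneg_right (h x hx).1 (Complex.normSq_nonneg _)

theorem energyForm_conj (K : Coefficients d) (u v : V d) :
    conj (energyForm K u v) = energyForm K v u := by
  simp only [energyForm, map_add, ← integral_conj, map_mul, map_sum, Complex.conj_ofReal,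
    Complex.conj_conj, mul_comm (conj _)]

theorem exists_coercive_bounds (K : Coefficients d) :
    ∃ α M : ℝ, 0 < α ∧ (∀ v, α * ‖v‖ ^ 2 ≤ (energyForm K v v).re) ∧
      ∀ u v, ‖energyForm K u v‖ ≤ M * ‖u‖ * ‖v‖ := by
  obtain ⟨a, c, ha, h⟩ := K.ν_bounds
  obtain ⟨a', c', ha', h'⟩ := K.σ_bounds
  have hg : ∀ (j : Fin d) (v : V d), ‖grad j v‖ ≤ ‖v‖ := fun j v => by
    refine le_of_sq_le_sq ?_ (norm_nonneg _)
    rw [norm_sq_V v]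
    have := Finset.single_le_sum (f := fun j => ‖grad j v‖ ^ 2) (fun _ _ => sq_nonneg _)
      (Finset.mem_univ j)
    nlinarith [sq_nonneg ‖toL2 d v‖]
  have h0 : ∀ v : V d, ‖toL2 d v‖ ≤ ‖v‖ := fun v => by
    refine le_of_sq_le_sq ?_ (norm_nonneg _)
    rw [norm_sq_V v]
    have := Finset.sum_nonneg (s := Finset.univ) (f := fun j => ‖grad j v‖ ^ 2)
      fun _ _ => sq_nonneg _
    linarith
  -- The absolute values spare a proof that the upper bounds `c`, `c'` are nonnegative; `d` counts
  -- the gradient components, each estimated separately.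
  refine ⟨min a a', d * |c| + |c'|, lt_min ha ha', fun v => ?_, fun u v => ?_⟩
  · rw [energyForm_eq, Complex.add_re, Complex.re_sum, norm_sq_V, add_comm, mul_add,
      Finset.mul_sum]
    refine add_le_add (Finset.sum_le_sum fun j _ => ?_) ?_
    · exact (mul_le_mul_of_nonneg_right (min_le_left _ _) (sq_nonneg _)).trans
        (le_re_inner_toLp_mul h _ _)
    · exact (mul_le_mul_of_nonneg_right (min_le_right _ _) (sq_nonneg _)).trans
        (le_re_inner_toLp_mul h' _ _)
  · rw [energyForm_eq]
    have key : ∀ {p q : L2 d} {m : (Fin d → ℝ) → ℝ} {a c : ℝ}, 0 < a →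
        (∀ x ∈ cube d, a ≤ m x ∧ m x ≤ c) → ‖p‖ ≤ ‖u‖ → ‖q‖ ≤ ‖v‖ →
        ∀ hm : MemLp (fun x => (m x : ℂ) * p x) 2 (cubeMeasure d),
        ‖inner ℂ q hm.toLp‖ ≤ |c| * (‖u‖ * ‖v‖) := by
      intro p q m a c ha h hp hq hm
      calc ‖inner ℂ q hm.toLp‖ ≤ ‖q‖ * ‖hm.toLp‖ := norm_inner_le_norm _ _
        _ ≤ ‖v‖ * (|c| * ‖u‖) := by
            gcongr
            exact (norm_toLp_mul_le ha h p hm).trans (mul_le_mul (le_abs_self c) hp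
              (norm_nonneg _) (abs_nonneg _))
        _ = _ := by ring
    refine (norm_add_le _ _).trans ?_
    have h1 := (norm_sum_le (Finset.univ : Finset (Fin d)) fun j => inner ℂ (grad j v)
      ((memLp_mul_of_bounds K.ν_meas K.ν_bounds (grad j u)).toLp _)).trans
      (Finset.sum_le_sum fun j _ => key ha h (hg j u) (hg j v) _)
    have h2 := key ha' h' (h0 u) (h0 v) (memLp_mul_of_bounds K.σ_meas K.σ_bounds (toL2 d u))
    simp only [Finset.sum_const, Finset.card_univ, Fintype.card_fin, nsmul_eq_mul] at h1
    refine (add_le_add h1 h2).trans_eq (by ring)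

/-- The operator on `V` representing the energy form. -/
theorem exists_energyOperator (K : Coefficients d) :
    ∃ T : V d →L[ℂ] V d, ∀ u v, inner ℂ v (T u) = energyForm K u v := by
  obtain ⟨α, M, -, -, hM⟩ := exists_coercive_bounds K
  exact exists_operator_of_form (fun u => map_add (opL K u))
    (fun c u v => map_smulₛₗ (opL K u) c v) (energyForm_conj K) hM

/-! ### Exponential kernels on `ℤ^d` -/

theorem freqNorm_nonneg (m : Fin d → ℤ) : 0 ≤ freqNorm m := Real.sqrt_nonneg _

theorem abs_le_freqNorm (m : Fin d → ℤ) (j : Fin d) : |(m j : ℝ)| ≤ freqNorm m := by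
  rw [freqNorm]
  refine Real.le_sqrt_of_sq_le ?_
  rw [sq_abs]
  exact Finset.single_le_sum (f := fun j => (m j : ℝ) ^ 2) (fun _ _ => sq_nonneg _)
    (Finset.mem_univ j)

theorem dist_le_freqNorm (l k : Fin d → ℤ) : dist l k ≤ freqNorm (l - k) := by
  refine (dist_pi_le_iff (freqNorm_nonneg _)).2 fun j => ?_
  rw [Int.dist_eq]
  exact_mod_cast abs_le_freqNorm (l - k) j

theorem summable_prod_pi {f : ℤ → ℝ} (hf0 : ∀ n, 0 ≤ f n) (hf : Summable f) (d : ℕ) :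
    Summable fun m : Fin d → ℤ => ∏ j, f (m j) := by
  induction d with
  | zero => exact Summable.of_finite
  | succ n ih =>
    rw [← (Fin.consEquiv fun _ : Fin (n + 1) => ℤ).summable_iff]
    refine (hf.mul_of_nonneg ih hf0 fun m => Finset.prod_nonneg fun _ _ => hf0 _).congr fun p => ?_
    simp [Fin.prod_univ_succ, Fin.consEquiv]

/-- Since `∑ |m_j| ≤ d |m|`, the kernel is dominated by a product of one-dimensional geometric
kernels of rate `δ / (d + 1)`; the `+ 1` keeps the denominator positive for every `d`. -/
theorem summable_exp_freqNorm {δ : ℝ} (hδ : 0 < δ) :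
    Summable fun m : Fin d → ℤ => Real.exp (-δ * freqNorm m) := by
  have hε : -(δ / (d + 1)) < 0 := by
    have : 0 < δ / (d + 1) := by positivity
    linarith
  have hf : Summable fun n : ℤ => Real.exp (|(n : ℝ)| * -(δ / (d + 1))) := by
    refine Summable.of_nat_of_neg ?_ ?_ <;>
    simpa using Real.summable_exp_nat_mul_iff.2 hε
  refine Summable.of_nonneg_of_le (fun _ => (Real.exp_pos _).le) (fun m => ?_)
    (summable_prod_pi (fun n => (Real.exp_pos _).le) hf d)
  rw [← Real.exp_sum, Real.exp_le_exp, ← Finset.sum_mul]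
  have h : ∑ j, |(m j : ℝ)| ≤ d * freqNorm m := by
    refine (Finset.sum_le_sum fun j _ => abs_le_freqNorm m j).trans_eq ?_
    simp
  have h2 : δ / (d + 1) * ∑ j, |(m j : ℝ)| ≤ δ * freqNorm m := by
    rw [div_mul_eq_mul_div, div_le_iff₀ (by positivity)]
    nlinarith [mul_le_mul_of_nonneg_left h hδ.le, mul_nonneg hδ.le (freqNorm_nonneg m)]
  linarith

/-- Convexity of `exp` between `0` and `x`. The factor `τ` is what makes the perturbation kernel
small. -/
theorem exp_mul_sub_one_le {τ x : ℝ} (h0 : 0 ≤ τ) (h1 : τ ≤ 1) :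
    Real.exp (τ * x) - 1 ≤ τ * Real.exp x := by
  have h := convexOn_exp.2 (Set.mem_univ x) (Set.mem_univ 0) h0 (sub_nonneg.2 h1) (by ring)
  simp only [smul_eq_mul, mul_zero, add_zero, Real.exp_zero, mul_one] at h
  linarith

/-- The lower side is `1 - e^{-y} ≤ e^y - 1`, that is, `cosh y ≥ 1`. -/
theorem abs_exp_sub_one_le {x y : ℝ} (h : |x| ≤ y) : |Real.exp x - 1| ≤ Real.exp y - 1 := by
  have h1 := Real.exp_le_exp.2 (abs_le.1 h).1
  have h2 := Real.exp_le_exp.2 (abs_le.1 h).2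
  have h3 := Real.add_one_le_exp y
  have h4 : 2 ≤ Real.exp y + Real.exp (-y) := by
    rw [Real.exp_neg]
    have := Real.exp_pos y
    have h5 : Real.exp y * (Real.exp y)⁻¹ = 1 := mul_inv_cancel₀ this.ne'
    nlinarith [sq_nonneg (Real.exp y - (Real.exp y)⁻¹), inv_pos.2 this]
  rw [abs_le]
  constructor <;> linarith

/-- The perturbation kernel produced by conjugation with slowly varying exponential weights
has small mass. -/
theorem exists_rate_kernel {ηL c α : ℝ} (hη : 0 < ηL) (hc : 0 < c) (hα : 0 < α) :
    ∃ θ : ℝ, 0 < θ ∧ ∃ κ : (Fin d → ℤ) → ℝ, Summable κ ∧ ∑' m, κ m ≤ α / 2 ∧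
      ∀ m, (Real.exp (θ * freqNorm m) - 1) * (c * Real.exp (-ηL * freqNorm m)) ≤ κ m := by
  have hs := summable_exp_freqNorm (d := d) (half_pos hη)
  set s := ∑' m : Fin d → ℤ, Real.exp (-(ηL / 2) * freqNorm m) with hsdef
  have hs0 : 0 ≤ s := tsum_nonneg fun _ => (Real.exp_pos _).le
  -- Half of the decay rate `ηL` pays for summability; this `τ` brings the total mass `c τ s` below
  -- `α / 2`.
  set τ := min 1 (α / (2 * c * s + 1)) with hτ
  have hden : 0 < 2 * c * s + 1 := by positivity
  have hτ0 : 0 < τ := lt_min one_pos (div_pos hα hden)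
  refine ⟨τ * (ηL / 2), by positivity,
    fun m => c * τ * Real.exp (-(ηL / 2) * freqNorm m), hs.mul_left _, ?_, fun m => ?_⟩
  · rw [tsum_mul_left, ← hsdef]
    have h : τ * (2 * c * s + 1) ≤ α := (le_div_iff₀ hden).1 (min_le_right _ _)
    nlinarith
  · have h := exp_mul_sub_one_le (x := ηL / 2 * freqNorm m) hτ0.le (min_le_left _ _)
    rw [mul_assoc τ]
    calc _ ≤ τ * Real.exp (ηL / 2 * freqNorm m) * (c * Real.exp (-ηL * freqNorm m)) := by gcongr
      _ = c * τ * (Real.exp (ηL / 2 * freqNorm m) * Real.exp (-ηL * freqNorm m)) := by ring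
      _ = _ := by
        rw [← Real.exp_add]
        ring_nf

/-- A truncated distance function to a finite set of frequencies. -/
theorem exists_truncated_dist (Λ : Finset (Fin d → ℤ)) (J : ℕ) :
    ∃ (ρ : (Fin d → ℤ) → ℝ) (S : Finset (Fin d → ℤ)), (∀ k, 0 ≤ ρ k) ∧ (∀ k, ρ k ≤ J) ∧
      (∀ l k, |ρ l - ρ k| ≤ dist l k) ∧ (∀ k ∈ Λ, ρ k = 0) ∧ (∀ k ∉ S, ρ k = J) ∧
      S.card ≤ Λ.card * (2 * J + 1) ^ d := by
  classical
  -- `Metric.infDist` to the empty set is `0` rather than infinite, so the empty case takes the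
  -- constant `J` instead.
  rcases Λ.eq_empty_or_nonempty with rfl | hΛ
  · exact ⟨fun _ => J, ∅, by simp⟩
  refine ⟨fun l => min J (Metric.infDist l (Λ : Set (Fin d → ℤ))),
    -- Distances here are in the sup norm, so the `J`-neighbourhood is a union of boxes with
    -- `(2J+1)^d` lattice points each.
    Λ.biUnion fun k => Finset.Icc (k - fun _ => (J : ℤ)) (k + fun _ => (J : ℤ)),
    fun k => le_min (Nat.cast_nonneg _) Metric.infDist_nonneg, fun k => min_le_left _ _,
    fun l k => ?_, fun k hk => ?_, fun l hl => ?_, ?_⟩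
  · refine (abs_min_sub_min_le_max _ _ _ _).trans (max_le (by simp) ?_)
    have h := (Metric.lipschitz_infDist_pt (Λ : Set (Fin d → ℤ))).dist_le_mul l k
    rwa [NNReal.coe_one, one_mul, Real.dist_eq] at h
  · have h := Metric.infDist_zero_of_mem (Finset.mem_coe.2 hk)
    simp [h]
  · refine min_eq_left ((Metric.le_infDist (Finset.coe_nonempty.2 hΛ)).2 fun k hk => ?_)
    by_contra! hlt
    refine hl (Finset.mem_biUnion.2 ⟨k, hk, Finset.mem_Icc.2 ?_⟩)
    have hj : ∀ j, |l j - k j| ≤ (J : ℤ) := fun j => by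
      have h := (dist_le_pi_dist l k j).trans hlt.le
      rw [Int.dist_eq] at h
      exact_mod_cast h
    constructor <;> intro j <;> have := abs_le.1 (hj j) <;>
      simp only [Pi.sub_apply, Pi.add_apply] <;> omega
  · refine Finset.card_biUnion_le_card_mul _ _ _ fun k _ => le_of_eq ?_
    rw [Pi.card_Icc]
    simp only [Pi.sub_apply, Pi.add_apply, Int.card_Icc]
    have : ∀ j, (k j + (J : ℤ) + 1 - (k j - J)).toNat = 2 * J + 1 := fun j => by omega
    simp [this]

/-! ### Approximation of the Galerkin residual -/

theorem bestErrorDual_le {f : Vdual d} {B : ℝ} (hB : 0 ≤ B) {N : ℕ} (Λ : Finset (Fin d → ℤ))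
    (hΛ : Λ.card = N) (h : ∀ v, (∀ k ∈ Λ, inner ℂ (basisV d k) v = 0) → ‖f v‖ ≤ B * ‖v‖) :
    bestErrorDual N f ≤ B := by
  refine (ciInf_le ⟨0, ?_⟩ (⟨Λ, hΛ⟩ : {Λ : Finset (Fin d → ℤ) // Λ.card = N})).trans ?_
  · rintro _ ⟨_, rfl⟩
    exact norm_nonneg (_ : Vdual d)
  · refine ContinuousLinearMap.opNorm_le_bound _ hB fun v => ?_
    rw [sub_projDual_apply]
    exact (h _ fun k hk => inner_basisV_sub_proj hk v).trans
      (mul_le_mul_of_nonneg_left (norm_sub_proj_le Λ v) hB)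

/-- Identifies the stiffness matrix with the matrix of the energy operator in the orthonormal basis,
which is where its decay enters the Schur test. -/
theorem energyForm_basisV (K : Coefficients d) (l k : Fin d → ℤ) :
    energyForm K (basisV d k) (basisV d l) = stiffness K l k := by
  have hs : ∀ (c : ℂ) (u v : V d), energyForm K u (c • v) = conj c * energyForm K u v :=
    fun c u v => map_smulₛₗ (opL K u) c v
  rw [basisV_apply, basisV_apply, modeV, modeV, hs, ← energyForm_conj, hs, map_mul,
    energyForm_conj, Complex.conj_conj, stiffness, map_inv₀, Complex.conj_ofReal, div_eq_mul_inv,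
    mul_inv]
  ring

/-- `norm_residual_le` with weights `exp (θ ρ)`. The constants depend on the operator only, not on
`Λ`, `Λ₀`, `J` or `N`. -/
theorem exists_residual_bound (hd : 1 ≤ d) (K : Coefficients d) {ηL : ℝ} (hη : 0 < ηL)
    (hA : ExpDecay (stiffness K) ηL) :
    ∃ θ C : ℝ, 0 < θ ∧ 0 < C ∧ ∀ (u w : V d) (Λ Λ₀ : Finset (Fin d → ℤ)) (J N : ℕ),
      IsGalerkin K (opL K u) Λ w → Λ₀.card * (2 * J + 1) ^ d ≤ N →
      bestErrorDual N (galerkinResidual K (opL K u) w) ≤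
        C * (Real.exp (-(θ * J)) * ‖u‖ + ‖u - proj Λ₀ u‖) := by
  obtain ⟨c, hc, hA⟩ := hA
  obtain ⟨α, -, hα, hco, -⟩ := exists_coercive_bounds K
  obtain ⟨T, hT⟩ := exists_energyOperator K
  obtain ⟨θ, hθ, κ, hκ, hκα, hκb⟩ := exists_rate_kernel (d := d) hη hc hα
  refine ⟨θ, (‖T‖ + α / 2) * (1 + 2 * (‖T‖ + α / 2) / α), hθ, by positivity,
    fun u w Λ Λ₀ J N hg hN => ?_⟩
  obtain ⟨ρ, S, hρ0, hρJ, hρd, hρΛ, hρS, hS⟩ := exists_truncated_dist Λ₀ J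
  have : Nonempty (Fin d) := ⟨⟨0, hd⟩⟩
  -- `bestErrorDual` uses sets of exactly `N` frequencies, so `S` is padded; `d ≥ 1` makes the
  -- frequency lattice infinite.
  obtain ⟨S', hSS', hS'⟩ := Infinite.exists_superset_card_eq S N (hS.trans hN)
  have hr : ∀ v, galerkinResidual K (opL K u) w v = inner ℂ v (T (u - w)) := fun v => by
    rw [map_sub]
    refine Eq.trans ?_ (inner_sub_right (𝕜 := ℂ) v (T u) (T w)).symm
    rw [hT, hT]
    rfl
  refine bestErrorDual_le (by positivity) S' hS' fun v hv => ?_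
  rw [hr, Real.exp_neg, proj_eq]
  refine norm_residual_le (b := basisV d) (Λ := Λ) (S := S) (w := fun k => Real.exp (θ * ρ k)) hα
    (fun x => by rw [hT]; exact hco x) (fun k => Real.one_le_exp (by have := hρ0 k; positivity))
    (fun k => ?_) (fun k hk => by rw [hρS k hk]) (fun k hk => by rw [hρΛ k hk]; simp)
    hκ hκα (fun l k => ?_) (by rw [← VΛ_eq]; exact hg.1) (fun v hv => ?_)
    fun k hk => hv k (hSS' hk)
  · have := hρJ k
    gcongr
  · rw [hT, energyForm_basisV, ← Real.exp_sub, ← mul_sub]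
    refine le_trans ?_ (hκb (l - k))
    refine mul_le_mul (abs_exp_sub_one_le ?_) (hA l k) (norm_nonneg _) ?_
    · rw [abs_mul, abs_of_pos hθ]
      have := (hρd l k).trans (dist_le_freqNorm l k)
      gcongr
    · rw [sub_nonneg]
      exact Real.one_le_exp (mul_nonneg hθ.le (freqNorm_nonneg _))
  · rw [← VΛ_eq] at hv
    rw [← hr]
    change opL K u v - energyForm K w v = 0
    rw [hg.2 v hv, sub_self]

/-! ### Balancing the parameters -/

theorem exists_mul_rpow_le {p q A δ : ℝ} (hq : 0 ≤ q) (hpq : q < p) (hA : 0 ≤ A) (hδ : 0 < δ) :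
    ∃ C, ∀ x : ℝ, 0 ≤ x → A * x ^ q ≤ δ * x ^ p + C := by
  -- The two powers `A x^q` and `δ x^p` cross at `x = (A / δ)^(1/(p-q))`; the constant is the value
  -- of the former there.
  refine ⟨A * ((A / δ) ^ (1 / (p - q))) ^ q, fun x hx => ?_⟩
  have hpq' : 0 < p - q := sub_pos.2 hpq
  have hX : 0 ≤ (A / δ) ^ (1 / (p - q)) := by positivity
  rcases le_total x ((A / δ) ^ (1 / (p - q))) with h | h
  · have h1 : 0 ≤ δ * x ^ p := by positivity
    have h2 : A * x ^ q ≤ A * ((A / δ) ^ (1 / (p - q))) ^ q := by gcongr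
    linarith
  · have h1 : A / δ ≤ x ^ (p - q) := by
      have := Real.rpow_le_rpow hX h hpq'.le
      rwa [← Real.rpow_mul (by positivity), one_div_mul_cancel hpq'.ne', Real.rpow_one] at this
    have h2 : x ^ p = x ^ (p - q) * x ^ q := by
      rw [← Real.rpow_add_of_nonneg hx hpq'.le hq, sub_add_cancel]
    have h3 : A ≤ δ * x ^ (p - q) := by
      rwa [div_le_iff₀' hδ] at h1
    have h4 : 0 ≤ A * ((A / δ) ^ (1 / (p - q))) ^ q := by positivity
    rw [h2, ← mul_assoc]
    have := mul_le_mul_of_nonneg_right h3 (Real.rpow_nonneg hx q)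
    linarith

theorem omega_pos (d : ℕ) : 0 < omega d :=
  ENNReal.toReal_pos (Metric.measure_ball_pos _ _ one_pos).ne' measure_ball_lt_top.ne

/-- Both sources of error decay with exponents in `N'` strictly above `t/(1+3t)/d`, so by
`exists_mul_rpow_le` the target weight is absorbed whatever the sizes of `θ` and `η`. -/
theorem exists_balanced_parameters (hd : 1 ≤ d) {η t θ : ℝ} (hη : 0 < η) (ht : 0 < t)
    (htd : t ≤ d) (hθ : 0 < θ) :
    ∃ C : ℝ, 0 < C ∧ ∀ N' : ℕ, ∃ N J : ℕ, N * (2 * J + 1) ^ d ≤ N' ∧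
      Real.exp (-(θ * J)) * gevreyWeight d η (t / (1 + 3 * t)) N' ≤ C ∧
      gevreyWeight d η (t / (1 + 3 * t)) N' ≤ C * gevreyWeight d η t N := by
  have hd0 : (0 : ℝ) < d := by exact_mod_cast hd
  have hω := omega_pos d
  set A := η * omega d ^ (-((t / (1 + 3 * t)) / d)) with hA
  set δ := η * omega d ^ (-(t / d)) with hδ
  have hA0 : 0 < A := by positivity
  have hδ0 : 0 < δ := by positivity
  have hlt : t / (1 + 3 * t) < t / (1 + 2 * t) := by gcongr; norm_num
  obtain ⟨C₁, hC₁⟩ := exists_mul_rpow_le (p := 2 * t / (1 + 2 * t) / d)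
    (q := t / (1 + 3 * t) / d) (A := A) (δ := θ / 2) (by positivity) (by
      refine div_lt_div_of_pos_right (hlt.trans ?_) hd0
      exact div_lt_div_of_pos_right (by linarith) (by positivity)) hA0.le (by positivity)
  obtain ⟨C₂, hC₂⟩ := exists_mul_rpow_le (p := t / (1 + 2 * t) / d)
    (q := t / (1 + 3 * t) / d) (A := A) (δ := δ) (by positivity) (by gcongr) hA0.le hδ0
  -- `3θ/2` pays for rounding `J` down, since `J ≥ (y - 3) / 2`; `δ` pays for rounding `N` down.
  refine ⟨Real.exp (max (C₁ + 3 * θ / 2) (C₂ + δ)), Real.exp_pos _, fun N' => ?_⟩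
  have hx : (0 : ℝ) ≤ N' := Nat.cast_nonneg _
  set x : ℝ := (N' : ℝ) with hxN
  set z := x ^ (1 / (1 + 2 * t)) with hz
  set y := x ^ (2 * t / (1 + 2 * t) / d) with hy
  have hz0 : 0 ≤ z := by positivity
  have hy0 : 0 ≤ y := by positivity
  -- Chosen so that `z * y ^ d = N'` and `2J + 1 ≤ y` when `N' ≥ 1`; for `N' = 0` the set size
  -- `⌊z⌋₊` is zero.
  refine ⟨⌊z⌋₊, ⌊(y - 1) / 2⌋₊, ?_, ?_, ?_⟩
  · rcases Nat.eq_zero_or_pos N' with h0 | h0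
    · have : z = 0 := by
        rw [hz, show x = 0 by simp [hxN, h0], Real.zero_rpow (by positivity)]
      simp [this]
    · have hx1 : 1 ≤ x := by
        rw [hxN]
        exact_mod_cast h0
      have hy1 : 1 ≤ y := Real.one_le_rpow hx1 (by positivity)
      have h1 : ((⌊z⌋₊ : ℕ) : ℝ) ≤ z := Nat.floor_le hz0
      have h2 : ((⌊(y - 1) / 2⌋₊ : ℕ) : ℝ) ≤ (y - 1) / 2 := Nat.floor_le (by linarith)
      have h3 : 2 * ((⌊(y - 1) / 2⌋₊ : ℕ) : ℝ) + 1 ≤ y := by linarith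
      have h4 : z * y ^ d = x := by
        rw [hz, hy, ← Real.rpow_natCast, ← Real.rpow_mul hx, div_mul_cancel₀ _ hd0.ne',
          ← Real.rpow_add (by linarith), ← add_div, div_self (by positivity), Real.rpow_one]
      have h5 : ((⌊z⌋₊ : ℕ) : ℝ) * (2 * ((⌊(y - 1) / 2⌋₊ : ℕ) : ℝ) + 1) ^ d ≤ x := by
        rw [← h4]
        gcongr
      rw [hxN] at h5
      exact_mod_cast h5
  · rw [gevreyWeight, ← Real.exp_add, Real.exp_le_exp]
    refine le_trans ?_ (le_max_left _ _)
    have h1 := hC₁ x hx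
    have h2 := (Nat.lt_floor_add_one ((y - 1) / 2)).le
    have h3 := mul_le_mul_of_nonneg_left h2 hθ.le
    rw [← hy] at h1
    linarith
  · rw [gevreyWeight, gevreyWeight, ← Real.exp_add, Real.exp_le_exp]
    refine le_trans ?_ (add_le_add_left (le_max_right _ _) _)
    have h1 := hC₂ x hx
    have htd1 : t / d ≤ 1 := (div_le_one hd0).2 htd
    have h2 : z ^ (t / d) = x ^ (t / (1 + 2 * t) / d) := by
      rw [hz, ← Real.rpow_mul hx]
      congr 1
      field_simp
    -- Subadditivity of the power `t/d ≤ 1`, where `t ≤ d` enters.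
    have h3 : z ^ (t / d) ≤ ((⌊z⌋₊ : ℕ) : ℝ) ^ (t / d) + 1 := by
      calc z ^ (t / d) ≤ (((⌊z⌋₊ : ℕ) : ℝ) + 1) ^ (t / d) := by
            have := (Nat.lt_floor_add_one z).le
            gcongr
        _ ≤ ((⌊z⌋₊ : ℕ) : ℝ) ^ (t / d) + 1 ^ (t / d) :=
            Real.rpow_add_le_add_rpow (Nat.cast_nonneg _) one_pos.le (by positivity) htd1
        _ = _ := by rw [Real.one_rpow]
    have h4 := mul_le_mul_of_nonneg_left h3 hδ0.le
    rw [h2] at h4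
    linarith

/-! ### From error bounds to sparsity norms, and the conclusion. -/

theorem bestError_nonneg (N : ℕ) (v : V d) : 0 ≤ bestError N v :=
  Real.iInf_nonneg fun _ => norm_nonneg _

/-- This is the term `N = 0` of the supremum, where the error is `‖u‖` and the weight is `1`. -/
theorem norm_le_sparsityNorm {η t : ℝ} (hd : 1 ≤ d) (ht : 0 < t) {u : V d}
    (hu : sparsityNorm η t u < ⊤) : ‖u‖ ≤ (sparsityNorm η t u).toReal := by
  have hd0 : (0 : ℝ) < d := by exact_mod_cast hd
  have h0 : ‖u‖ ≤ bestError 0 u := by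
    have : Nonempty {Λ : Finset (Fin d → ℤ) // Λ.card = 0} := ⟨⟨∅, rfl⟩⟩
    refine le_ciInf fun Λ => ?_
    rw [Finset.card_eq_zero.1 Λ.2]
    simp [proj]
  have hw : gevreyWeight d η t 0 = 1 := by
    rw [gevreyWeight, Nat.cast_zero, Real.zero_rpow (by positivity)]
    simp
  rw [← ENNReal.ofReal_le_iff_le_toReal hu.ne]
  refine le_trans (ENNReal.ofReal_le_ofReal ?_)
    (le_iSup (fun N : ℕ => ENNReal.ofReal (bestError N u * gevreyWeight d η t N)) 0)
  rw [hw, mul_one]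
  exact h0

theorem bestError_mul_le_sparsityNorm {η t : ℝ} {u : V d} (hu : sparsityNorm η t u < ⊤) (N : ℕ) :
    bestError N u * gevreyWeight d η t N ≤ (sparsityNorm η t u).toReal := by
  rw [← ENNReal.ofReal_le_iff_le_toReal hu.ne]
  exact le_iSup (fun N : ℕ => ENNReal.ofReal (bestError N u * gevreyWeight d η t N)) N

/-- The Galerkin residual of a function in `𝒜_G^{η,t}` lies in `𝒜_G^{η,t/(1+3t)}`. -/
theorem exists_sparsityNormDual_residual_le (hd : 1 ≤ d) {η t : ℝ} (hη : 0 < η) (ht : 0 < t)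
    (htd : t ≤ d) (K : Coefficients d) {ηL : ℝ} (hηL : 0 < ηL)
    (hA : ExpDecay (stiffness K) ηL) :
    ∃ C : ℝ≥0, ∀ (u w : V d) (Λ : Finset (Fin d → ℤ)), u ∈ SparsityClass d η t →
      IsGalerkin K (opL K u) Λ w →
      sparsityNormDual η (t / (1 + 3 * t)) (galerkinResidual K (opL K u) w) ≤
        C * sparsityNorm η t u := by
  obtain ⟨θ, C, hθ, hC, hres⟩ := exists_residual_bound hd K hηL hA
  obtain ⟨C', hC', hbal⟩ := exists_balanced_parameters hd hη ht htd hθ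
  have : Nonempty (Fin d) := ⟨⟨0, hd⟩⟩
  refine ⟨⟨2 * C * C', by positivity⟩, fun u w Λ hu hg => iSup_le fun N' => ?_⟩
  have hu' : sparsityNorm η t u < ⊤ := hu
  obtain ⟨N, J, hNJ, h1, h2⟩ := hbal N'
  set X := (sparsityNorm η t u).toReal with hX
  set e := Real.exp (-(θ * J)) with he
  have hW : 0 < gevreyWeight d η (t / (1 + 3 * t)) N' := Real.exp_pos _
  set W := gevreyWeight d η (t / (1 + 3 * t)) N' with hWdef
  set E := bestErrorDual N' (galerkinResidual K (opL K u) w) with hE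
  -- The residual bound holds for every `Λ₀` with `N` elements; written as a lower bound for `‖u -
  -- P_{Λ₀} u‖`, it passes to the infimum without a best set having to exist.
  have hE1 : E / C - e * ‖u‖ ≤ bestError N u := by
    obtain ⟨Λ₁, hΛ₁⟩ := Infinite.exists_subset_card_eq (Fin d → ℤ) N
    have : Nonempty {Λ : Finset (Fin d → ℤ) // Λ.card = N} := ⟨⟨Λ₁, hΛ₁⟩⟩
    refine le_ciInf fun Λ₀ => ?_
    have h := hres u w Λ Λ₀.1 J N' hg (by rw [Λ₀.2]; exact hNJ)
    rw [sub_le_iff_le_add', div_le_iff₀' hC]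
    exact h
  have hE2 : E ≤ C * (e * ‖u‖ + bestError N u) := by
    rwa [sub_le_iff_le_add', div_le_iff₀' hC] at hE1
  have hX1 : ‖u‖ ≤ X := norm_le_sparsityNorm hd ht hu'
  have hX2 : bestError N u * gevreyWeight d η t N ≤ X := bestError_mul_le_sparsityNorm hu' N
  have hfin : E * W ≤ 2 * C * C' * X := by
    have a1 : e * W * ‖u‖ ≤ C' * X := mul_le_mul h1 hX1 (norm_nonneg _) hC'.le
    have a2 : bestError N u * W ≤ C' * X :=
      calc bestError N u * W ≤ bestError N u * (C' * gevreyWeight d η t N) :=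
            mul_le_mul_of_nonneg_left h2 (bestError_nonneg N u)
        _ = C' * (bestError N u * gevreyWeight d η t N) := by ring
        _ ≤ _ := mul_le_mul_of_nonneg_left hX2 hC'.le
    calc E * W ≤ C * (e * ‖u‖ + bestError N u) * W := mul_le_mul_of_nonneg_right hE2 hW.le
      _ = C * (e * W * ‖u‖ + bestError N u * W) := by ring
      _ ≤ C * (C' * X + C' * X) := by gcongr
      _ = _ := by ring
  calc ENNReal.ofReal (E * W) ≤ ENNReal.ofReal (2 * C * C' * X) := ENNReal.ofReal_le_ofReal hfin
    _ = _ := by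
      rw [ENNReal.ofReal_mul (by positivity), hX, ENNReal.ofReal_toReal hu'.ne,
        ENNReal.ofReal_eq_coe_nnreal (by positivity : (0 : ℝ) ≤ 2 * C * C')]
      rfl

end FourierGalerkin

theorem mainTheorem7 (d : ℕ) (hd1 : 1 ≤ d) (hd10 : d ≤ 10) (η t : ℝ) (hη : 0 < η)
    (ht : 0 < t) (htd : t ≤ d) :
    ∃ ηbar tbar : ℝ, 0 < ηbar ∧ ηbar ≤ η ∧ 0 < tbar ∧ tbar ≤ t ∧ tbar = t / (1 + 3 * t) ∧
      ∀ (K : Coefficients d) (Ainv : (Fin d → ℤ) → (Fin d → ℤ) → ℂ) (ηL ηLbar : ℝ),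
        0 < ηLbar → ηLbar ≤ ηL →
        ExpDecay (stiffness K) ηL →
        IsInverseMatrix (stiffness K) Ainv →
        ExpDecay Ainv ηLbar →
        η < omega d ^ (t / (d * (1 + 2 * t))) * ηLbar →
        ∃ C : ℝ≥0, ∀ (f : Vdual d) (u : V d),
          opL K u = f →
          u ∈ SparsityClass d η t →
          ∀ (Λ : Finset (Fin d → ℤ)) (uΛ : V d), IsGalerkin K f Λ uΛ →
            galerkinResidual K f uΛ ∈ SparsityClassDual d ηbar tbar ∧
            sparsityNormDual ηbar tbar (galerkinResidual K f uΛ) ≤ C * sparsityNorm η t u := by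
  -- The rate is kept, `η̄ = η`: lowering the exponent to `t/(1+3t)` already leaves enough room.
  refine ⟨η, t / (1 + 3 * t), hη, le_rfl, by positivity, div_le_self ht.le (by linarith), rfl,
    fun K _ ηL ηLbar hb hbL hA _ _ _ => ?_⟩
  obtain ⟨C, hC⟩ := exists_sparsityNormDual_residual_le hd1 hη ht htd K (hb.trans_le hbL) hA
  refine ⟨C, ?_⟩
  rintro _ u rfl hu Λ w hg
  have h := hC u w Λ hu hg
  exact ⟨h.trans_lt (ENNReal.mul_lt_top ENNReal.coe_lt_top hu), h⟩
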